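/- Let $\mathbf{k}$ be a commutative ring (for instance a field), let $q\in\mathbf{k}$ and let $n,k\ge 0$ be integers. Let $\mathcal{H}_n$ be the Hecke algebra of the symmetric group $S_n$, that is, the unital associative $\mathbf{k}$-algebra with generators $T_1,\dots,T_{n-1}$ and relations $T_i^2=(q-1)T_i+q$, $T_iT_j=T_jT_i$ for $|i-j|>1$, and $T_iT_{i+1}T_i=T_{i+1}T_iT_{i+1}$; let $a\mapsto a^*$ be the algebra anti-automorphism of $\mathcal{H}_n$ fixing each $T_i$. It is a free $\mathbf{k}$-module of rank $n!$. For $m\le n$ put $\mathcal{B}_m=\sum_{i=1}^m T_{m-1}T_{m-2}\cdots T_i$ (so $\mathcal{B}_m=0$ for $m\le 0$), let $\mathcal{B}_{n,k}=\mathcal{B}_{n-k+1}\cdots\mathcal{B}_{n-1}\mathcal{B}_n$, and define the $k$-random-to-random shuffle $$\mathcal{R}_{n,k}=\frac{1}{[k]!_q}\,\mathcal{B}_{n,k}^*\,\mathcal{B}_{n,k},\qquad [k]!_q=\prod_{i=1}^k(1+q+\cdots+q^{i-1}),$$ where the division is performed for an indeterminate $q$ (over $\mathbb{Z}[q]$,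 where it is possible and unique) and the given value of $q$ is substituted afterwards. Then all eigenvalues of $\mathcal{R}_{n,k}$, acting on $\mathcal{H}_n$ by right multiplication, are polynomials in $q$ with integer coefficients. That is, there is a finite multiset of polynomials $p_1,\dots,p_N\in\mathbb{Z}[t]$, depending only on $n$ and $k$ (and not on $\mathbf{k}$ or $q$), such that for every commutative ring $\mathbf{k}$ and every $q\in\mathbf{k}$ the characteristic polynomial of the $\mathbf{k}$-linear map $\mathcal{H}_n\to\mathcal{H}_n$, $a\mapsto a\,\mathcal{R}_{n,k}$, equals $$\prod_{i=1}^N\bigl(x-p_i(q)\bigr),$$ and, if $\mathbf{k}$ is an integral domain, every eigenvalue of this map in $\mathbf{k}$ is one of the $p_i(q)$. -/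

import Mathlib

namespace QShuffle

open Polynomial

section Hecke

variable {R : Type*} [CommRing R]

/-- The defining relations of the Hecke algebra `H_n(q)` on generators `T_1, …, T_{n-1}`. -/
inductive HeckeRel (q : R) (n : ℕ) :
    FreeAlgebra R (Finset.Ico 1 n) → FreeAlgebra R (Finset.Ico 1 n) → Prop
  | quad (i : Finset.Ico 1 n) :
      HeckeRel q n (FreeAlgebra.ι R i ^ 2)
        ((q - 1) • FreeAlgebra.ι R i + algebraMap R _ q)
  | comm (i j : Finset.Ico 1 n) (h : 1 < |((i : ℕ) : ℤ) - ((j : ℕ) : ℤ)|) :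
      HeckeRel q n (FreeAlgebra.ι R i * FreeAlgebra.ι R j)
        (FreeAlgebra.ι R j * FreeAlgebra.ι R i)
  | braid (i j : Finset.Ico 1 n) (h : (j : ℕ) = (i : ℕ) + 1) :
      HeckeRel q n (FreeAlgebra.ι R i * FreeAlgebra.ι R j * FreeAlgebra.ι R i)
        (FreeAlgebra.ι R j * FreeAlgebra.ι R i * FreeAlgebra.ι R j)

/-- The Hecke algebra `H_n(q)` of the symmetric group `S_n` over a commutative ring `R`. -/
def Hecke (q : R) (n : ℕ) : Type _ := RingQuot (HeckeRel q n)

instance (q : R) (n : ℕ) : Ring (Hecke q n) := inferInstanceAs (Ring (RingQuot (HeckeRel q n)))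

instance (q : R) (n : ℕ) : Algebra R (Hecke q n) :=
  inferInstanceAs (Algebra R (RingQuot (HeckeRel q n)))

/-- The quotient map from the free algebra. -/
def mk (q : R) (n : ℕ) : FreeAlgebra R (Finset.Ico 1 n) →ₐ[R] Hecke q n :=
  RingQuot.mkAlgHom R (HeckeRel q n)

theorem mk_rel {q : R} {n : ℕ} {x y : FreeAlgebra R (Finset.Ico 1 n)} (h : HeckeRel q n x y) :
    mk q n x = mk q n y := RingQuot.mkAlgHom_rel R h

/-- The generator `T_i` of `H_n(q)`, for `1 ≤ i ≤ n - 1` (and `0` for all other `i`). -/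
def T (q : R) (n i : ℕ) : Hecke q n :=
  if h : i ∈ Finset.Ico 1 n then mk q n (FreeAlgebra.ι R ⟨i, h⟩)
  else 0

theorem T_eq_mk (q : R) (n : ℕ) (i : Finset.Ico 1 n) :
    T q n i = mk q n (FreeAlgebra.ι R i) := by
  unfold T; exact dif_pos i.2

theorem T_eq_zero (q : R) {n i : ℕ} (h : i ∉ Finset.Ico 1 n) : T q n i = 0 := by
  unfold T; exact dif_neg h

theorem T_sq (q : R) {n i : ℕ} (h1 : 1 ≤ i) (h2 : i < n) :
    T q n i * T q n i = (q - 1) • T q n i + algebraMap R _ q := by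
  have h : i ∈ Finset.Ico 1 n := Finset.mem_Ico.2 ⟨h1, h2⟩
  have := mk_rel (HeckeRel.quad (q := q) (n := n) ⟨i, h⟩)
  rw [map_pow, map_add, map_smul, AlgHom.commutes, ← T_eq_mk, sq] at this
  exact this

theorem T_comm (q : R) (n : ℕ) {i j : ℕ} (hij : i + 1 < j) :
    T q n i * T q n j = T q n j * T q n i := by
  by_cases hi : i ∈ Finset.Ico 1 n
  · by_cases hj : j ∈ Finset.Ico 1 n
    · have := mk_rel (HeckeRel.comm (q := q) (n := n) ⟨i, hi⟩ ⟨j, hj⟩ (by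
        simp only; rw [abs_sub_comm, abs_of_nonneg] <;> omega))
      rw [map_mul, map_mul, ← T_eq_mk, ← T_eq_mk] at this
      exact this
    · simp [T_eq_zero q hj]
  · simp [T_eq_zero q hi]

theorem T_braid (q : R) {n i : ℕ} (h1 : 1 ≤ i) (h2 : i + 1 < n) :
    T q n i * T q n (i + 1) * T q n i = T q n (i + 1) * T q n i * T q n (i + 1) := by
  have hi : i ∈ Finset.Ico 1 n := Finset.mem_Ico.2 ⟨h1, by omega⟩
  have hj : i + 1 ∈ Finset.Ico 1 n := Finset.mem_Ico.2 ⟨by omega, h2⟩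
  have := mk_rel (HeckeRel.braid (q := q) (n := n) ⟨i, hi⟩ ⟨i + 1, hj⟩ rfl)
  simp only [map_mul, ← T_eq_mk] at this
  exact this

/-- The universal property of the Hecke algebra. -/
def lift (q : R) (n : ℕ) {A : Type*} [Ring A] [Algebra R A] (t : ℕ → A)
    (hq : ∀ i, 1 ≤ i → i < n → t i * t i = (q - 1) • t i + algebraMap R A q)
    (hc : ∀ i j, 1 ≤ i → i + 1 < j → j < n → t i * t j = t j * t i)
    (hb : ∀ i, 1 ≤ i → i + 1 < n → t i * t (i + 1) * t i = t (i + 1) * t i * t (i + 1)) :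
    Hecke q n →ₐ[R] A :=
  RingQuot.liftAlgHom R ⟨FreeAlgebra.lift R fun i : Finset.Ico 1 n => t i, by
    rintro _ _ (⟨⟨i, hi⟩⟩ | ⟨⟨i, hi⟩, ⟨j, hj⟩, h⟩ | ⟨⟨i, hi⟩, ⟨j, hj⟩, h⟩)
    · rw [Finset.mem_Ico] at hi
      simpa [sq, -algebraMap_smul] using hq i hi.1 hi.2
    · rw [Finset.mem_Ico] at hi hj
      simp only [map_mul, FreeAlgebra.lift_ι_apply]
      simp only [lt_abs] at h
      rcases h with h | h
      · exact (hc j i hj.1 (by omega) hi.2).symm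
      · exact hc i j hi.1 (by omega) hj.2
    · rw [Finset.mem_Ico] at hi hj
      simp only at h
      subst h
      simpa using hb i hi.1 hj.2⟩

theorem lift_T (q : R) (n : ℕ) {A : Type*} [Ring A] [Algebra R A] (t : ℕ → A) (hq hc hb)
    {i : ℕ} (h1 : 1 ≤ i) (h2 : i < n) : lift q n t hq hc hb (T q n i) = t i := by
  have h : i ∈ Finset.Ico 1 n := Finset.mem_Ico.2 ⟨h1, h2⟩
  have h' : T q n i = mk q n (FreeAlgebra.ι R ⟨i, h⟩) :=
    T_eq_mk q n ⟨i, h⟩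
  rw [h']
  exact (RingQuot.liftAlgHom_mkAlgHom_apply R _ _ _).trans (by simp)

theorem adjoin_T (q : R) (n : ℕ) :
    Algebra.adjoin R {x | ∃ i, 1 ≤ i ∧ i < n ∧ x = T q n i} = ⊤ := by
  have h : (mk q n).range = ⊤ :=
    (AlgHom.range_eq_top _).2 (RingQuot.mkAlgHom_surjective R _)
  have h2 : (⊤ : Subalgebra R (Hecke q n)) =
      Algebra.adjoin R ((mk q n) '' (Set.range (FreeAlgebra.ι R))) := by
    rw [← AlgHom.map_adjoin, FreeAlgebra.adjoin_range_ι, Algebra.map_top, h]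
  refine eq_top_iff.2 (h2.le.trans (Algebra.adjoin_mono ?_))
  rintro _ ⟨_, ⟨i, rfl⟩, rfl⟩
  exact ⟨i, (Finset.mem_Ico.1 i.2).1, (Finset.mem_Ico.1 i.2).2, (T_eq_mk q n i).symm⟩

/-- The anti-automorphism `a ↦ a^*` of `H_n(q)` that fixes every `T_i`, as an algebra
homomorphism to the opposite algebra. -/
def starHom (q : R) (n : ℕ) : Hecke q n →ₐ[R] (Hecke q n)ᵐᵒᵖ :=
  lift q n (fun i => MulOpposite.op (T q n i))
    (fun i h1 h2 => by
      rw [← MulOpposite.op_mul, T_sq q h1 h2]; rfl)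
    (fun i j _ h _ => by
      rw [← MulOpposite.op_mul, ← MulOpposite.op_mul, T_comm q n h])
    (fun i h1 h2 => by
      simp only [← MulOpposite.op_mul]
      rw [← mul_assoc, T_braid q h1 h2, mul_assoc])

/-- The anti-automorphism `a ↦ a^*` of `H_n(q)` that fixes every `T_i`. -/
def hstar {q : R} {n : ℕ} (a : Hecke q n) : Hecke q n := (starHom q n a).unop

/-- The homomorphism `H_n(q) → H_n(q')`, `T_i ↦ T_i`, induced by a ring homomorphism `f` of the
base rings with `f q = q'`. -/
def baseChange {S : Type*} [CommRing S] (f : R →+* S) (q : R) (q' : S) (h : f q = q') (n : ℕ) :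
    Hecke q n →+* Hecke q' n :=
  letI : Algebra R (Hecke q' n) := Algebra.compHom (Hecke q' n) f
  (lift q n (fun i => T q' n i)
    (fun i h1 h2 => by
      subst h
      rw [T_sq (f q) h1 h2, Algebra.smul_def, Algebra.smul_def, ← map_one f, ← map_sub]
      rfl)
    (fun i j _ hij _ => T_comm q' n hij)
    (fun i h1 h2 => T_braid q' h1 h2)).toRingHom

end Hecke

/-! ### The shuffles -/

section Shuffles

variable {R : Type*} [CommRing R]

/-- The `q`-integer `[k]_q = 1 + q + ⋯ + q^(k-1)`. -/
def qInt (q : R) (k : ℕ) : R := ∑ i ∈ Finset.range k, q ^ i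

/-- The `q`-factorial `[k]!_q = [1]_q [2]_q ⋯ [k]_q`. -/
def qFactorial (q : R) (k : ℕ) : R := ∏ i ∈ Finset.Icc 1 k, qInt q i

/-- The product `T_{m-1} T_{m-2} ⋯ T_i` in `H_n(q)` (equal to `1` for `i = m`). -/
def descProd (q : R) (n m i : ℕ) : Hecke q n :=
  ((List.range' i (m - i)).reverse.map (T q n)).prod

/-- The element `B_m = ∑_{i=1}^m T_{m-1} T_{m-2} ⋯ T_i` of `H_m(q)`, regarded as an element of
`H_n(q)` for `n ≥ m`. -/
def B (q : R) (n m : ℕ) : Hecke q n := ∑ i ∈ Finset.Icc 1 m, descProd q n m i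

/-- The `k`-bottom-to-random shuffle `B_{m,k} = B_{m-(k-1)} ⋯ B_{m-1} B_m` of `H_m(q)`, regarded as
an element of `H_n(q)` for `n ≥ m`. (Truncated subtraction is harmless here, as `B_0 = 0`.) -/
def Bk (q : R) (n m k : ℕ) : Hecke q n :=
  ((List.range k).reverse.map fun j => B q n (m - j)).prod

/-- The `k`-bottom-to-random shuffle `B_{n,k}` in `H_n(q)`. -/
def bottomToRandom (q : R) (n k : ℕ) : Hecke q n := Bk q n n k

/-- The `k`-random-to-bottom shuffle `B_{n,k}^*` in `H_n(q)`. -/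
def randomToBottom (q : R) (n k : ℕ) : Hecke q n := hstar (bottomToRandom q n k)

end Shuffles
end QShuffle

namespace QShuffle
open Polynomial
section Divisibility

variable {R : Type*} [CommRing R]

theorem hstar_add {q : R} {n : ℕ} (a b : Hecke q n) : hstar (a + b) = hstar a + hstar b := by
  simp [hstar]

theorem hstar_mul {q : R} {n : ℕ} (a b : Hecke q n) : hstar (a * b) = hstar b * hstar a := by
  simp [hstar]

theorem hstar_one {q : R} {n : ℕ} : hstar (1 : Hecke q n) = 1 := by
  simp [hstar]

theorem hstar_zero {q : R} {n : ℕ} : hstar (0 : Hecke q n) = 0 := by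
  simp [hstar]

theorem hstar_T (q : R) (n i : ℕ) : hstar (T q n i) = T q n i := by
  by_cases h : i ∈ Finset.Ico 1 n
  · have h' := Finset.mem_Ico.1 h
    unfold hstar starHom
    rw [lift_T q n _ _ _ _ h'.1 h'.2]; rfl
  · rw [T_eq_zero q h, hstar_zero]

theorem descProd_self (q : R) (n m : ℕ) : descProd q n m m = 1 := by
  simp [descProd]

theorem descProd_succ (q : R) (n : ℕ) {m i : ℕ} (h : i ≤ m) :
    descProd q n (m + 1) i = T q n m * descProd q n m i := by
  have h1 : m + 1 - i = (m - i) + 1 := by omega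
  have h2 : i + (m - i) = m := by omega
  simp [descProd, h1, List.range'_concat, h2]

theorem B_zero (q : R) (n : ℕ) : B q n 0 = 0 := by simp [B]

theorem B_succ (q : R) (n m : ℕ) : B q n (m + 1) = 1 + T q n m * B q n m := by
  rw [B, Finset.sum_Icc_succ_top (by omega), descProd_self, add_comm, B, Finset.mul_sum]
  congr 1
  exact Finset.sum_congr rfl fun i hi => descProd_succ q n (Finset.mem_Icc.1 hi).2

theorem T_comm_B (q : R) (n : ℕ) {m j : ℕ} (h : m < j) :
    T q n j * B q n m = B q n m * T q n j := by
  induction m with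
  | zero => simp [B_zero]
  | succ m ih =>
    rw [B_succ, mul_add, add_mul, ← mul_assoc, ← T_comm q n h, mul_assoc, ih (by omega)]
    simp [mul_assoc]

theorem T_mul_B_mul_B (q : R) {n m : ℕ} (h1 : 1 ≤ m) (h2 : m < n) :
    T q n m * (B q n m * B q n (m + 1)) = q • (B q n m * B q n (m + 1)) := by
  induction m, h1 using Nat.le_induction with
  | base =>
    simp only [B_succ, B_zero, mul_zero, add_zero, mul_one, one_mul, mul_add]
    rw [T_sq q le_rfl h2, Algebra.algebraMap_eq_smul_one, sub_smul, one_smul, smul_add]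
    abel
  | succ m h1 ih =>
    have ih := ih (by omega)
    have hc := T_comm_B q n (show m < m + 1 by omega)
    have hb := T_braid q h1 h2
    have hs := T_sq q (show 1 ≤ m + 1 by omega) h2
    rw [B_succ q n (m + 1)]
    set b := B q n (m + 1) with hbdef
    have hbb : b = 1 + T q n m * B q n m := B_succ q n m
    set t := T q n (m + 1)
    set u := T q n m
    set c := B q n m
    -- `t * b * t = t * t + u * t * u * c`
    have e1 : t * b * t = t * t + u * t * u * c := by
      rw [hb, hbb, mul_add, add_mul, mul_one]
      simp only [mul_assoc]
      rw [hc]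
    have e2 : u * c * b = q • (c * b) := by rw [mul_assoc]; exact ih
    have e3 : u * c = b - 1 := by rw [hbb]; abel
    have e4 : t * b * t * b = t * t * b + q • (u * c * t * b) := by
      rw [e1, add_mul]
      congr 1
      calc u * t * u * c * b = u * t * (u * c * b) := by simp only [mul_assoc]
        _ = q • (u * (t * c) * b) := by rw [e2, mul_smul_comm]; simp only [mul_assoc]
        _ = _ := by rw [hc]; simp only [mul_assoc]
    have e5 : t * (b * (1 + t * b)) = t * b + t * b * t * b := by
      simp only [mul_add, mul_one, mul_assoc]
    rw [e5, e4, e3, hs]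
    simp only [Algebra.algebraMap_eq_smul_one, add_mul, sub_mul, smul_mul_assoc, one_mul,
      mul_add, mul_one, smul_add, smul_sub, sub_smul, one_smul, mul_assoc]
    abel

/-- `Z p r = B_{p+1} ⋯ B_{p+r}`. -/
def Z (q : R) (n p : ℕ) : ℕ → Hecke q n
  | 0 => 1
  | r + 1 => Z q n p r * B q n (p + r + 1)

/-- `S p r = ∑_{i=p+1}^{p+r} T_{p+r-1} ⋯ T_i`. -/
def S (q : R) (n p : ℕ) : ℕ → Hecke q n
  | 0 => 0
  | r + 1 => 1 + T q n (p + r) * S q n p r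

/-- `D p r = T_{p+r-1} ⋯ T_p`. -/
def D (q : R) (n p : ℕ) : ℕ → Hecke q n
  | 0 => 1
  | r + 1 => T q n (p + r) * D q n p r

theorem Bk_succ (q : R) (n m k : ℕ) : Bk q n m (k + 1) = Bk q n (m - 1) k * B q n m := by
  simp only [Bk]
  rw [List.range_succ_eq_map]
  simp only [List.reverse_cons, List.map_append, List.prod_append, List.map_cons, List.map_nil,
    List.prod_cons, List.prod_nil, mul_one, Nat.sub_zero, ← List.map_reverse, List.map_map]
  congr 3
  funext j
  simp only [Function.comp]
  congr 1
  omega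

theorem Bk_eq_Z (q : R) (n p r : ℕ) : Bk q n (p + r) r = Z q n p r := by
  induction r with
  | zero => simp [Bk, Z]
  | succ r ih =>
    rw [Bk_succ, Z, ← ih]; rfl

theorem Bk_eq_zero (q : R) (n : ℕ) {m k : ℕ} (h : m < k) : Bk q n m k = 0 := by
  apply List.prod_eq_zero
  simp only [List.mem_map, List.mem_reverse, List.mem_range]
  exact ⟨m, h, by simp [B_zero]⟩

theorem Z_left (q : R) (n p r : ℕ) : Z q n p (r + 1) = B q n (p + 1) * Z q n (p + 1) r := by
  induction r with
  | zero => simp [Z]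
  | succ r ih =>
    rw [Z, ih, Z, mul_assoc, show p + (r + 1) + 1 = p + 1 + r + 1 by omega]

theorem T_comm_Z (q : R) (n p : ℕ) {r j : ℕ} (h : p + r < j) :
    T q n j * Z q n p r = Z q n p r * T q n j := by
  induction r with
  | zero => simp [Z]
  | succ r ih =>
    rw [Z, ← mul_assoc, ih (by omega), mul_assoc, T_comm_B q n (by omega), mul_assoc]

theorem T_mul_Z (q : R) {n p r j : ℕ} (h1 : p < j) (h2 : j < p + r) (h3 : p + r ≤ n) :
    T q n j * Z q n p r = q • Z q n p r := by
  induction r with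
  | zero => omega
  | succ r ih =>
    rcases Nat.lt_or_ge j (p + r) with h | h
    · rw [Z, ← mul_assoc, ih h (by omega), smul_mul_assoc]
    · obtain rfl : j = p + r := by omega
      obtain ⟨r, rfl⟩ : ∃ s, r = s + 1 := ⟨r - 1, by omega⟩
      have := T_mul_B_mul_B q (show 1 ≤ p + (r + 1) by omega) (show p + (r + 1) < n by omega)
      rw [Z, Z, mul_assoc, ← mul_assoc, T_comm_Z q n p (by omega), mul_assoc]
      rw [show p + r + 1 = p + (r + 1) by omega, this, mul_smul_comm]

theorem Z_succ (q : R) (n p r : ℕ) :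
    Z q n p (r + 1) = (hstar (S q n p (r + 1)) + hstar (D q n p (r + 1)) * B q n p) * Z q n p r := by
  induction r with
  | zero => simp [Z, S, D, hstar_T, hstar_one, B_succ]
  | succ r ih =>
    have hc := T_comm_Z q n p (show p + r < p + (r + 1) by omega)
    have hc2 := T_comm_B q n (show p < p + (r + 1) by omega)
    have hS : hstar (S q n p (r + 1 + 1)) = 1 + hstar (S q n p (r + 1)) * T q n (p + (r + 1)) := by
      rw [S, hstar_add, hstar_mul, hstar_one, hstar_T]
    have hD : hstar (D q n p (r + 1 + 1)) = hstar (D q n p (r + 1)) * T q n (p + (r + 1)) := by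
      rw [D, hstar_mul, hstar_T]
    rw [hS, hD, Z, B_succ, mul_add, mul_one]
    generalize hstar (S q n p (r + 1)) = s at *
    generalize hstar (D q n p (r + 1)) = d at *
    have e : Z q n p (r + 1) * (T q n (p + (r + 1)) * B q n (p + (r + 1)))
      = (s + d * B q n p) * T q n (p + (r + 1)) * Z q n p (r + 1) := by
      nth_rw 1 [ih]
      rw [mul_assoc, ← mul_assoc (Z q n p r), ← hc, Z]
      simp only [mul_assoc]
      rfl
    rw [e]
    simp only [add_mul, mul_assoc, one_mul]
    rw [← mul_assoc (B q n p), ← hc2]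
    simp only [mul_assoc, add_assoc]

theorem qInt_succ (q : R) (k : ℕ) : qInt q (k + 1) = 1 + q * qInt q k := by
  rw [qInt, Finset.sum_range_succ', qInt, Finset.mul_sum, add_comm]
  simp [pow_succ']

theorem qFactorial_succ (q : R) (k : ℕ) :
    qFactorial q (k + 1) = qFactorial q k * qInt q (k + 1) := by
  rw [qFactorial, Finset.prod_Icc_succ_top (by omega), qFactorial]

theorem S_mul {q : R} {n p r : ℕ} (z : Hecke q n)
    (hz : ∀ j, p < j → j < p + r → T q n j * z = q • z) : S q n p r * z = qInt q r • z := by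
  induction r with
  | zero => simp [S, qInt]
  | succ r ih =>
    rw [S, add_mul, one_mul, mul_assoc, ih fun j h1 h2 => hz j h1 (by omega), mul_smul_comm]
    rcases Nat.eq_zero_or_pos r with rfl | hr
    · simp [qInt]
    · rw [hz (p + r) (by omega) (by omega), qInt_succ, add_smul, one_smul, smul_smul, mul_comm q]

theorem T_comm_D (q : R) {n p r j : ℕ} (h : p + r < j) :
    T q n j * D q n p r = D q n p r * T q n j := by
  induction r with
  | zero => simp [D]
  | succ r ih =>
    rw [D, ← mul_assoc, ← T_comm q n (by omega), mul_assoc, ih (by omega), mul_assoc]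

theorem T_mul_D (q : R) {n p r j : ℕ} (h1 : 1 ≤ p) (h2 : p ≤ j) (h3 : j + 1 < p + r)
    (h4 : p + r ≤ n) : T q n j * D q n p r = D q n p r * T q n (j + 1) := by
  induction r with
  | zero => omega
  | succ r ih =>
    rcases Nat.lt_or_ge (j + 1) (p + r) with h | h
    · rw [D, ← mul_assoc, T_comm q n (by omega), mul_assoc, ih h (by omega), mul_assoc]
    · obtain ⟨r, rfl⟩ : ∃ s, r = s + 1 := ⟨r - 1, by omega⟩
      obtain rfl : j = p + r := by omega
      rw [D, D, ← add_assoc, ← mul_assoc, ← mul_assoc, T_braid q (by omega) (by omega),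
        mul_assoc, mul_assoc, mul_assoc, mul_assoc, T_comm_D q (by omega)]

theorem exists_smul_eq_hstar_Z_mul (q : R) (n r p : ℕ) (h : p + r ≤ n) (z : Hecke q n)
    (hz : ∀ j, p < j → j < p + r → T q n j * z = q • z) :
    ∃ x, qFactorial q r • x = hstar (Z q n p r) * z := by
  induction r generalizing p z with
  | zero => exact ⟨z, by simp [Z, qFactorial, hstar_one]⟩
  | succ r ihr =>
    induction p generalizing z with
    | zero =>
      obtain ⟨x, hx⟩ := ihr 0 (by omega) z fun j h1 h2 => hz j h1 (by omega)
      refine ⟨x, ?_⟩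
      rw [Z_succ, B_zero, mul_zero, add_zero, hstar_mul, mul_assoc]
      have : hstar (hstar (S q n 0 (r + 1))) = S q n 0 (r + 1) := by
        generalize r + 1 = k
        induction k with
        | zero => simp [S, hstar_zero]
        | succ k ih => rw [S, hstar_add, hstar_mul, hstar_add, hstar_mul, ih]; simp [hstar_one, hstar_T]
      rw [this, S_mul z hz, mul_smul_comm, ← hx, smul_smul, qFactorial_succ, mul_comm]
    | succ p ihp =>
      obtain ⟨x, hx⟩ := ihr (p + 1) (by omega) z fun j h1 h2 => hz j h1 (by omega)
      obtain ⟨y, hy⟩ := ihp (by omega) (D q n (p + 1) (r + 1) * z) (by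
        intro j h1 h2
        rw [← mul_assoc, T_mul_D q (by omega) (by omega) (by omega) h, mul_assoc,
          hz _ (by omega) (by omega), mul_smul_comm])
      refine ⟨x + y, ?_⟩
      have hS : ∀ k, hstar (hstar (S q n (p + 1) k)) = S q n (p + 1) k := by
        intro k
        induction k with
        | zero => simp [S, hstar_zero]
        | succ k ih => rw [S, hstar_add, hstar_mul, hstar_add, hstar_mul, ih]; simp [hstar_one, hstar_T]
      have hD : ∀ k, hstar (hstar (D q n (p + 1) k)) = D q n (p + 1) k := by
        intro k
        induction k with
        | zero => simp [D, hstar_one]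
        | succ k ih => rw [D, hstar_mul, hstar_mul, ih]; simp [hstar_T]
      rw [smul_add, hy, Z_succ q n (p + 1) r, hstar_mul, hstar_add, hstar_mul, hS, hD, mul_assoc, add_mul,
        S_mul z hz, mul_add, Z_left, hstar_mul, qFactorial_succ, mul_comm, mul_smul, hx,
        mul_smul_comm]
      simp only [mul_assoc]

/-- `B_{n,k}^* B_{n,k}` is divisible by `[k]!_q`. -/
theorem exists_smul_eq (q : R) (n k : ℕ) :
    ∃ x : Hecke q n, qFactorial q k • x = randomToBottom q n k * bottomToRandom q n k := by
  rcases Nat.lt_or_ge n k with h | h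
  · exact ⟨0, by simp [bottomToRandom, Bk_eq_zero q n h]⟩
  · obtain ⟨p, rfl⟩ := Nat.exists_eq_add_of_le' h
    simp only [randomToBottom, bottomToRandom, Bk_eq_Z]
    exact exists_smul_eq_hstar_Z_mul q _ k p le_rfl _ fun j h1 h2 => T_mul_Z q h1 h2 le_rfl

end Divisibility
end QShuffle

namespace QShuffle
section Basis

variable {R : Type*} [CommRing R]

/-- The transposition of the positions `i - 1` and `i` (counted from `0`). -/
def sw {n i : ℕ} (h1 : 1 ≤ i) (h2 : i < n) : Equiv.Perm (Fin n) :=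
  Equiv.swap ⟨i - 1, by omega⟩ ⟨i, h2⟩

/-- The action of `T_i` on the free module on `S_n`. -/
noncomputable def act (q : R) (n i : ℕ) :
    (Equiv.Perm (Fin n) →₀ R) →ₗ[R] (Equiv.Perm (Fin n) →₀ R) :=
  if h : 1 ≤ i ∧ i < n then
    Finsupp.linearCombination R fun v =>
      if v ⟨i - 1, by omega⟩ < v ⟨i, h.2⟩ then Finsupp.single (v * sw h.1 h.2) 1
      else q • Finsupp.single (v * sw h.1 h.2) 1 + (q - 1) • Finsupp.single v 1
  else 0

theorem act_single (q : R) {n i : ℕ} (h1 : 1 ≤ i) (h2 : i < n) (v : Equiv.Perm (Fin n)) :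
    act q n i (Finsupp.single v 1) =
      if v ⟨i - 1, by omega⟩ < v ⟨i, h2⟩ then Finsupp.single (v * sw h1 h2) 1
      else q • Finsupp.single (v * sw h1 h2) 1 + (q - 1) • Finsupp.single v 1 := by
  simp only [act, dif_pos (And.intro h1 h2), Finsupp.linearCombination_single, one_smul]

theorem act_sq (q : R) {n i : ℕ} (h1 : 1 ≤ i) (h2 : i < n) :
    act q n i * act q n i = (q - 1) • act q n i + algebraMap R _ q := by
  refine Finsupp.lhom_ext' fun v => LinearMap.ext_ring ?_
  have e : v * sw h1 h2 * sw h1 h2 = v := by simp [sw, mul_assoc]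
  have ha : (v * sw h1 h2) ⟨i - 1, by omega⟩ = v ⟨i, h2⟩ := by simp [sw]
  have hb : (v * sw h1 h2) ⟨i, h2⟩ = v ⟨i - 1, by omega⟩ := by simp [sw]
  have hne : v ⟨i - 1, by omega⟩ ≠ v ⟨i, h2⟩ := by
    intro h; have := v.injective h; simp at this; omega
  simp only [LinearMap.comp_apply, Finsupp.lsingle_apply, Module.End.mul_apply,
    LinearMap.add_apply, LinearMap.smul_apply, Module.algebraMap_end_apply]
  rcases lt_or_gt_of_ne hne with h | h
  · rw [act_single q h1 h2 v, if_pos h, act_single q h1 h2, ha, hb, if_neg h.not_gt, e, add_comm]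
  · rw [act_single q h1 h2 v, if_neg h.not_gt, map_add, map_smul, map_smul, act_single q h1 h2, ha, hb,
      if_pos h, e, act_single q h1 h2, if_neg h.not_gt, add_comm]

theorem act_comm (q : R) {n i j : ℕ} (h1 : 1 ≤ i) (h : i + 1 < j) (h2 : j < n) :
    act q n i * act q n j = act q n j * act q n i := by
  refine Finsupp.lhom_ext' fun v => LinearMap.ext_ring ?_
  have hi : i < n := by omega
  have hj : 1 ≤ j := by omega
  have e : ∀ v, v * sw hj h2 * sw h1 hi = v * sw h1 hi * sw hj h2 := by
    intro v
    rw [mul_assoc, mul_assoc]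
    congr 1
    apply Equiv.Perm.Disjoint.commute
    intro x
    simp only [sw]
    by_cases hx : (x : ℕ) = i - 1 ∨ (x : ℕ) = i
    · left; apply Equiv.swap_apply_of_ne_of_ne <;> simp [Fin.ext_iff] <;> omega
    · right; apply Equiv.swap_apply_of_ne_of_ne <;> simp [Fin.ext_iff] <;> omega
  have a1 : ∀ v : Equiv.Perm (Fin n), (v * sw hj h2) ⟨i - 1, by omega⟩ = v ⟨i - 1, by omega⟩ := by
    intro v
    rw [Equiv.Perm.mul_apply, sw, Equiv.swap_apply_of_ne_of_ne] <;> simp [Fin.ext_iff] <;> omega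
  have a2 : ∀ v : Equiv.Perm (Fin n), (v * sw hj h2) ⟨i, hi⟩ = v ⟨i, hi⟩ := by
    intro v
    rw [Equiv.Perm.mul_apply, sw, Equiv.swap_apply_of_ne_of_ne] <;> simp [Fin.ext_iff] <;> omega
  have a3 : ∀ v : Equiv.Perm (Fin n), (v * sw h1 hi) ⟨j - 1, by omega⟩ = v ⟨j - 1, by omega⟩ := by
    intro v
    rw [Equiv.Perm.mul_apply, sw, Equiv.swap_apply_of_ne_of_ne] <;> simp [Fin.ext_iff] <;> omega
  have a4 : ∀ v : Equiv.Perm (Fin n), (v * sw h1 hi) ⟨j, h2⟩ = v ⟨j, h2⟩ := by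
    intro v
    rw [Equiv.Perm.mul_apply, sw, Equiv.swap_apply_of_ne_of_ne] <;> simp [Fin.ext_iff] <;> omega
  simp only [LinearMap.comp_apply, Finsupp.lsingle_apply, Module.End.mul_apply]
  rw [act_single q hj h2 v, act_single q h1 hi v]
  split_ifs with c1 c2 c2 <;>
    simp only [map_add, map_smul, act_single q hj h2, act_single q h1 hi, a1, a2, a3, a4, c1, c2,
      if_true, if_false, e, smul_add]
  all_goals first | done | module

theorem act_braid (q : R) {n i : ℕ} (h1 : 1 ≤ i) (h2 : i + 1 < n) :
    act q n i * act q n (i + 1) * act q n i =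
      act q n (i + 1) * act q n i * act q n (i + 1) := by
  refine Finsupp.lhom_ext' fun v => LinearMap.ext_ring ?_
  have hi : i < n := by omega
  have hj : 1 ≤ i + 1 := by omega
  have es : ∀ v, v * sw h1 hi * sw h1 hi = v := by simp [sw, mul_assoc]
  have et : ∀ v, v * sw hj h2 * sw hj h2 = v := by simp [sw, mul_assoc]
  have n1 : (⟨i - 1, by omega⟩ : Fin n) ≠ ⟨i, hi⟩ := by simp [Fin.ext_iff]; omega
  have n2 : (⟨i, hi⟩ : Fin n) ≠ ⟨i + 1, h2⟩ := by simp [Fin.ext_iff]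
  have n3 : (⟨i - 1, by omega⟩ : Fin n) ≠ ⟨i + 1, h2⟩ := by
    intro h; simp only [Fin.mk.injEq] at h; omega
  have hs1 : ∀ v, act q n i (Finsupp.single v 1) =
      if v ⟨i - 1, by omega⟩ < v ⟨i, hi⟩ then Finsupp.single (v * sw h1 hi) 1
      else q • Finsupp.single (v * sw h1 hi) 1 + (q - 1) • Finsupp.single v 1 := act_single q h1 hi
  have hs2 : ∀ v, act q n (i + 1) (Finsupp.single v 1) =
      if v ⟨i, hi⟩ < v ⟨i + 1, h2⟩ then Finsupp.single (v * sw hj h2) 1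
      else q • Finsupp.single (v * sw hj h2) 1 + (q - 1) • Finsupp.single v 1 :=
    act_single q hj h2
  have hs : sw h1 hi = Equiv.swap ⟨i - 1, by omega⟩ ⟨i, hi⟩ := rfl
  have ht : sw hj h2 = Equiv.swap ⟨i, hi⟩ ⟨i + 1, h2⟩ := rfl
  generalize sw h1 hi = s at *
  generalize sw hj h2 = t at *
  generalize (⟨i - 1, by omega⟩ : Fin n) = a at *
  generalize (⟨i, hi⟩ : Fin n) = b at *
  generalize (⟨i + 1, h2⟩ : Fin n) = c at *
  have eb : ∀ v, v * s * t * s = v * t * s * t := by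
    intro v
    simp only [mul_assoc]
    congr 1
    rw [hs, ht]
    ext x
    by_cases xa : x = a
    · subst xa; simp [Equiv.swap_apply_def, n1, n3, n2.symm, n3.symm]
    by_cases xb : x = b
    · subst xb; simp [Equiv.swap_apply_def, n1, n3, n2.symm, n3.symm]
    by_cases xc : x = c
    · subst xc; simp [Equiv.swap_apply_def, n1, n3, n2.symm, n3.symm]
    simp [Equiv.swap_apply_def, xa, xb, xc]
  have sa : ∀ v : Equiv.Perm (Fin n), (v * s) a = v b := by simp [hs]
  have sb : ∀ v : Equiv.Perm (Fin n), (v * s) b = v a := by simp [hs]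
  have sc : ∀ v : Equiv.Perm (Fin n), (v * s) c = v c := by
    intro v; rw [hs, Equiv.Perm.mul_apply, Equiv.swap_apply_of_ne_of_ne n3.symm n2.symm]
  have ta : ∀ v : Equiv.Perm (Fin n), (v * t) a = v a := by
    intro v; rw [ht, Equiv.Perm.mul_apply, Equiv.swap_apply_of_ne_of_ne n1 n3]
  have tb : ∀ v : Equiv.Perm (Fin n), (v * t) b = v c := by simp [ht]
  have tc : ∀ v : Equiv.Perm (Fin n), (v * t) c = v b := by simp [ht]
  have m1 : v a ≠ v b := fun h => n1 (v.injective h)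
  have m2 : v b ≠ v c := fun h => n2 (v.injective h)
  have m3 : v a ≠ v c := fun h => n3 (v.injective h)
  simp only [LinearMap.comp_apply, Finsupp.lsingle_apply, Module.End.mul_apply]
  rcases lt_or_gt_of_ne m1 with k1 | k1 <;> rcases lt_or_gt_of_ne m2 with k2 | k2 <;>
    rcases lt_or_gt_of_ne m3 with k3 | k3 <;>
    first
    | (exfalso; omega)
    | (simp only [map_add, map_smul, hs1, hs2, sa, sb, sc, ta, tb, tc, k1, k2, k3, k1.not_gt,
        k2.not_gt, k3.not_gt, if_true, if_false, es, et, eb, smul_add]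
       try module)

/-- The representation of `H_n(q)` on the free module on `S_n`. -/
noncomputable def rep (q : R) (n : ℕ) : Hecke q n →ₐ[R] Module.End R (Equiv.Perm (Fin n) →₀ R) :=
  lift q n (act q n) (fun _ => act_sq q) (fun _ _ => act_comm q) (fun _ => act_braid q)

theorem rep_T (q : R) {n i : ℕ} (h1 : 1 ≤ i) (h2 : i < n) : rep q n (T q n i) = act q n i :=
  lift_T q n _ _ _ _ h1 h2

theorem exists_rep_eq (q : R) (n : ℕ) (v : Equiv.Perm (Fin n)) :
    ∃ x : Hecke q n, rep q n x (Finsupp.single 1 1) = Finsupp.single v 1 := by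
  -- induction on the number of inversions, measured by the weight below
  let w : Equiv.Perm (Fin n) → ℕ := fun v => ∑ a : Fin n, (a : ℕ) * (n - (v a : ℕ))
  induction hN : w v using Nat.strong_induction_on generalizing v with
  | _ N ih =>
  by_cases hd : ∃ i : ℕ, ∃ (h1 : 1 ≤ i) (h2 : i < n), v ⟨i, h2⟩ < v ⟨i - 1, by omega⟩
  · obtain ⟨i, h1, h2, hlt⟩ := hd
    have hne : (⟨i - 1, by omega⟩ : Fin n) ≠ ⟨i, h2⟩ := by simp [Fin.ext_iff]; omega
    have hw : w (v * sw h1 h2) < w v := by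
      have key : ∀ u : Equiv.Perm (Fin n), w u =
          (i - 1) * (n - (u ⟨i - 1, by omega⟩ : ℕ)) + i * (n - (u ⟨i, h2⟩ : ℕ)) +
          ∑ a ∈ (Finset.univ.erase (⟨i - 1, by omega⟩ : Fin n)).erase ⟨i, h2⟩,
            (a : ℕ) * (n - (u a : ℕ)) := by
        intro u
        simp only [w]
        rw [← Finset.add_sum_erase _ _ (Finset.mem_univ (⟨i - 1, by omega⟩ : Fin n)),
          ← Finset.add_sum_erase _ _ (Finset.mem_erase.2 ⟨hne.symm, Finset.mem_univ _⟩), add_assoc]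
      rw [key, key v]
      have h3 : (v * sw h1 h2) ⟨i - 1, by omega⟩ = v ⟨i, h2⟩ := by simp [sw]
      have h4 : (v * sw h1 h2) ⟨i, h2⟩ = v ⟨i - 1, by omega⟩ := by simp [sw]
      rw [h3, h4]
      have h5 : ∑ a ∈ (Finset.univ.erase (⟨i - 1, by omega⟩ : Fin n)).erase ⟨i, h2⟩,
            (a : ℕ) * (n - ((v * sw h1 h2) a : ℕ)) =
          ∑ a ∈ (Finset.univ.erase (⟨i - 1, by omega⟩ : Fin n)).erase ⟨i, h2⟩,
            (a : ℕ) * (n - (v a : ℕ)) := by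
        refine Finset.sum_congr rfl fun a ha => ?_
        simp only [Finset.mem_erase] at ha
        rw [Equiv.Perm.mul_apply, sw, Equiv.swap_apply_of_ne_of_ne ha.2.1 ha.1]
      rw [h5]
      obtain ⟨m, rfl⟩ : ∃ m, i = m + 1 := ⟨i - 1, by omega⟩
      have hx := (v ⟨m + 1 - 1, by omega⟩).2
      have hlt' : (v ⟨m + 1, h2⟩ : ℕ) < v ⟨m + 1 - 1, by omega⟩ := hlt
      generalize (v ⟨m + 1, h2⟩ : ℕ) = x at *
      generalize (v ⟨m + 1 - 1, by omega⟩ : ℕ) = y at *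
      have h6 : n - y < n - x := by omega
      simp only [Nat.add_sub_cancel, add_mul, one_mul]
      omega
    obtain ⟨x, hx⟩ := ih _ (hN ▸ hw) _ rfl
    refine ⟨T q n i * x, ?_⟩
    rw [map_mul, Module.End.mul_apply, hx, rep_T q h1 h2, act_single q h1 h2, if_pos]
    · simp [sw, mul_assoc]
    · simpa [sw] using hlt
  · push Not at hd
    have hmono : Monotone v := by
      rcases n with _ | n
      · intro a; exact a.elim0
      · refine Fin.monotone_iff_le_succ.2 fun a => ?_
        have := hd (a + 1) (by omega) (by omega)
        exact this
    have : v = 1 := by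
      have h2 := hmono.strictMono_of_injective v.injective
      have := Subsingleton.elim (h2.orderIsoOfSurjective v v.surjective) (OrderIso.refl _)
      ext a
      exact congrArg Fin.val (DFunLike.congr_fun this a)
    exact ⟨1, by simp [this]⟩

/-- Evaluation of the representation at the identity permutation. -/
noncomputable def evalOne (q : R) (n : ℕ) : Hecke q n →ₗ[R] (Equiv.Perm (Fin n) →₀ R) :=
  (LinearMap.applyₗ (Finsupp.single 1 1)).comp (rep q n).toLinearMap

theorem evalOne_surjective (q : R) (n : ℕ) : Function.Surjective (evalOne q n) := by
  intro f
  rw [← LinearMap.mem_range]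
  induction f using Finsupp.induction_linear with
  | zero => exact Submodule.zero_mem _
  | add f g hf hg => exact Submodule.add_mem _ hf hg
  | single v c =>
    obtain ⟨x, hx⟩ := exists_rep_eq q n v
    refine ⟨c • x, ?_⟩
    have hx' : evalOne q n x = Finsupp.single v 1 := hx
    rw [map_smul, hx', Finsupp.smul_single, smul_eq_mul, mul_one]

/-- `T_i T_{i+1} ⋯ T_{i+r-1}`. -/
def asc (q : R) (n i : ℕ) : ℕ → Hecke q n
  | 0 => 1
  | r + 1 => asc q n i r * T q n (i + r)

/-- The subalgebra generated by `T_1, …, T_{m-1}`. -/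
def sub (q : R) (n m : ℕ) : Subalgebra R (Hecke q n) :=
  Algebra.adjoin R {x | ∃ i, 1 ≤ i ∧ i < m ∧ x = T q n i}

theorem T_mem_sub (q : R) (n : ℕ) {m i : ℕ} (h1 : 1 ≤ i) (h2 : i < m) : T q n i ∈ sub q n m :=
  Algebra.subset_adjoin ⟨i, h1, h2, rfl⟩

theorem asc_succ' (q : R) (n i r : ℕ) : asc q n i (r + 1) = T q n i * asc q n (i + 1) r := by
  induction r with
  | zero => simp [asc]
  | succ r ih => rw [asc, ih, asc, mul_assoc, show i + (r + 1) = i + 1 + r by omega]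

theorem T_comm_asc (q : R) (n i r : ℕ) {j : ℕ} (h : j + 1 < i ∨ i + r < j) :
    T q n j * asc q n i r = asc q n i r * T q n j := by
  induction r with
  | zero => simp [asc]
  | succ r ih =>
    have : T q n (i + r) * T q n j = T q n j * T q n (i + r) := by
      rcases h with h | h
      · exact (T_comm q n (by omega)).symm
      · exact T_comm q n (by omega)
    rw [asc, ← mul_assoc, ih (by omega), mul_assoc, ← this, mul_assoc]

theorem T_mul_asc (q : R) {n i r j : ℕ} (h1 : 1 ≤ i) (h2 : i < j) (h3 : j < i + r)
    (h4 : i + r ≤ n) : T q n j * asc q n i r = asc q n i r * T q n (j - 1) := by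
  induction r with
  | zero => omega
  | succ r ih =>
    rcases Nat.lt_or_ge j (i + r) with h | h
    · rw [asc, ← mul_assoc, ih h (by omega), mul_assoc, mul_assoc, T_comm q n (by omega)]
    · obtain ⟨r, rfl⟩ : ∃ s, r = s + 1 := ⟨r - 1, by omega⟩
      obtain rfl : j = i + r + 1 := by omega
      rw [asc, asc, ← mul_assoc, ← mul_assoc, T_comm_asc q n i r (by omega), Nat.add_sub_cancel,
        ← add_assoc]
      have := T_braid q (show 1 ≤ i + r by omega) (show i + r + 1 < n by omega)
      simp only [mul_assoc] at this ⊢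
      rw [this]

theorem sub_le_span (q : R) {n m : ℕ} (hm : 1 ≤ m) (h : m + 1 ≤ n) :
    Subalgebra.toSubmodule (sub q n (m + 1)) ≤
      Submodule.span R {x | ∃ i ∈ Finset.Icc 1 (m + 1), ∃ u ∈ sub q n m,
        x = asc q n i (m + 1 - i) * u} := by
  set W := Submodule.span R {x | ∃ i ∈ Finset.Icc 1 (m + 1), ∃ u ∈ sub q n m,
        x = asc q n i (m + 1 - i) * u} with hW
  have gen : ∀ i u, 1 ≤ i → i ≤ m + 1 → u ∈ sub q n m → asc q n i (m + 1 - i) * u ∈ W :=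
    fun i u h1 h2 hu => Submodule.subset_span ⟨i, Finset.mem_Icc.2 ⟨h1, h2⟩, u, hu, rfl⟩
  have key : ∀ x ∈ sub q n (m + 1), ∀ y ∈ W, x * y ∈ W := by
    intro x hx
    induction hx using Algebra.adjoin_induction with
    | mem x hx =>
      obtain ⟨j, hj1, hj2, rfl⟩ := hx
      intro y hy
      induction hy using Submodule.span_induction with
      | zero => simp
      | add a b _ _ ha hb => rw [mul_add]; exact W.add_mem ha hb
      | smul c a _ ha => rw [mul_smul_comm]; exact W.smul_mem _ ha
      | mem y hy =>
        obtain ⟨i, hi, u, hu, rfl⟩ := hy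
        rw [Finset.mem_Icc] at hi
        rcases lt_trichotomy j i with hji | rfl | hji
        · rcases Nat.lt_or_ge (j + 1) i with hji' | hji'
          · rw [← mul_assoc, T_comm_asc q n _ _ (Or.inl hji'), mul_assoc]
            exact gen _ _ hi.1 hi.2 (mul_mem (T_mem_sub q n hj1 (by omega)) hu)
          · obtain rfl : i = j + 1 := by omega
            rw [← mul_assoc, ← asc_succ', show m + 1 - (j + 1) + 1 = m + 1 - j by omega]
            exact gen _ _ hj1 (by omega) hu
        · have e : m + 1 - j = (m + 1 - (j + 1)) + 1 := by omega
          have h3 := gen (j + 1) u (by omega) (by omega) hu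
          have h4 := gen j u hj1 (by omega) hu
          rw [e, asc_succ'] at h4 ⊢
          rw [← mul_assoc, ← mul_assoc, T_sq q hj1 (by omega), Algebra.algebraMap_eq_smul_one,
            add_mul, add_mul, smul_mul_assoc, smul_mul_assoc, smul_mul_assoc, smul_mul_assoc,
            one_mul]
          exact W.add_mem (W.smul_mem _ h4) (W.smul_mem _ h3)
        · rw [← mul_assoc, T_mul_asc q hi.1 hji (by omega) (by omega), mul_assoc]
          exact gen _ _ hi.1 hi.2 (mul_mem (T_mem_sub q n (by omega) (by omega)) hu)
    | algebraMap r =>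
      intro y hy; rw [← Algebra.smul_def]; exact W.smul_mem _ hy
    | add a b _ _ ha hb => intro y hy; rw [add_mul]; exact W.add_mem (ha y hy) (hb y hy)
    | mul a b _ _ ha hb => intro y hy; rw [mul_assoc]; exact ha _ (hb y hy)
  intro x hx
  have h1 : (1 : Hecke q n) ∈ W := by
    simpa [asc] using gen (m + 1) 1 (by omega) le_rfl (one_mem _)
  simpa using key x hx 1 h1

theorem exists_span (q : R) (n m : ℕ) (h : m ≤ n) : ∃ b : Fin m.factorial → Hecke q n,
    Subalgebra.toSubmodule (sub q n m) ≤ Submodule.span R (Set.range b) := by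
  have base : ∀ m ≤ 1, Subalgebra.toSubmodule (sub q n m) ≤
      Submodule.span R {(1 : Hecke q n)} := by
    intro m hm
    have : {x | ∃ i, 1 ≤ i ∧ i < m ∧ x = T q n i} = ∅ := by
      ext x; simp; intro i h1 h2; omega
    rw [sub, this, Algebra.adjoin_empty, Algebra.toSubmodule_bot, Submodule.one_eq_span]
  induction m with
  | zero => exact ⟨fun _ => 1, (base 0 (by omega)).trans (Submodule.span_mono (by
      rintro _ rfl; exact ⟨⟨0, by simp⟩, rfl⟩))⟩
  | succ m ih =>
    rcases Nat.eq_zero_or_pos m with rfl | hm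
    · exact ⟨fun _ => 1, (base 1 le_rfl).trans (Submodule.span_mono (by
        rintro _ rfl; exact ⟨⟨0, by simp⟩, rfl⟩))⟩
    · obtain ⟨b, hb⟩ := ih (by omega)
      let e : Fin (m + 1) × Fin m.factorial ≃ Fin (m + 1).factorial := finProdFinEquiv
      refine ⟨fun a => asc q n ((e.symm a).1 + 1) (m + 1 - ((e.symm a).1 + 1)) * b (e.symm a).2,
        (sub_le_span q hm h).trans (Submodule.span_le.2 ?_)⟩
      rintro _ ⟨i, hi, u, hu, rfl⟩
      rw [Finset.mem_Icc] at hi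
      have hu' := hb hu
      simp only [SetLike.mem_coe]
      clear hu
      induction hu' using Submodule.span_induction with
      | zero => simp
      | add a b _ _ ha hb => rw [mul_add]; exact Submodule.add_mem _ ha hb
      | smul c a _ ha => rw [mul_smul_comm]; exact Submodule.smul_mem _ _ ha
      | mem y hy =>
        obtain ⟨l, rfl⟩ := hy
        refine Submodule.subset_span ⟨e (⟨i - 1, by omega⟩, l), ?_⟩
        simp only [Equiv.symm_apply_apply]
        rw [show i - 1 + 1 = i by omega]

theorem exists_linearEquiv (q : R) (n : ℕ) :
    Nonempty (Hecke q n ≃ₗ[R] (Equiv.Perm (Fin n) →₀ R)) := by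
  obtain ⟨b, hb⟩ := exists_span q n n le_rfl
  have htop : Submodule.span R (Set.range b) = ⊤ := by
    rw [eq_top_iff, ← Algebra.top_toSubmodule, ← adjoin_T q n]; exact hb
  let e : Equiv.Perm (Fin n) ≃ Fin n.factorial :=
    Fintype.equivFinOfCardEq (by rw [Fintype.card_perm, Fintype.card_fin])
  let g : (Equiv.Perm (Fin n) →₀ R) →ₗ[R] Hecke q n := Finsupp.linearCombination R (b ∘ e)
  have hg : Function.Surjective g := by
    rw [← LinearMap.range_eq_top, Finsupp.range_linearCombination, Set.range_comp,
      e.range_eq_univ, Set.image_univ, htop]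
  have hf := evalOne_surjective q n
  have hinj : Function.Injective ((evalOne q n).comp g) :=
    OrzechProperty.injective_of_surjective_endomorphism _ (hf.comp hg)
  have hg' : Function.Injective g := fun x y hxy => hinj (by simp [hxy])
  exact ⟨(LinearEquiv.ofBijective g ⟨hg', hg⟩).symm⟩

instance (q : R) (n : ℕ) : Module.Free R (Hecke q n) :=
  Module.Free.of_equiv (exists_linearEquiv q n).some.symm

instance (q : R) (n : ℕ) : Module.Finite R (Hecke q n) :=
  Module.Finite.equiv (exists_linearEquiv q n).some.symm

end Basis
end QShuffle

namespace QShuffle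
section Generic

variable {R : Type*} [CommRing R]

open Polynomial

theorem hstar_hstar {q : R} {n : ℕ} (a : Hecke q n) : hstar (hstar a) = a := by
  let f : Hecke q n →ₐ[R] Hecke q n :=
    (AlgEquiv.opOp R (Hecke q n)).symm.toAlgHom.comp ((AlgHom.op (starHom q n)).comp (starHom q n))
  have hf : ∀ a, f a = hstar (hstar a) := fun a => rfl
  have ha : a ∈ Algebra.adjoin R {x | ∃ i, 1 ≤ i ∧ i < n ∧ x = T q n i} := by
    rw [adjoin_T]; trivial
  rw [← hf]
  induction ha using Algebra.adjoin_induction with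
  | mem x hx =>
    obtain ⟨i, _, _, rfl⟩ := hx
    rw [hf, hstar_T, hstar_T]
  | algebraMap r => exact f.commutes r
  | add a b _ _ ha hb => rw [map_add, ha, hb]
  | mul a b _ _ ha hb => rw [map_mul, ha, hb]

theorem qFactorial_X_ne_zero (k : ℕ) : qFactorial (X : ℤ[X]) k ≠ 0 := by
  intro h
  have := congrArg (eval 1) h
  simp only [qFactorial, qInt, eval_prod, eval_finsetSum, eval_pow, eval_X, one_pow,
    Finset.sum_const, Finset.card_range, eval_zero, nsmul_eq_mul, mul_one] at this
  rw [Finset.prod_eq_zero_iff] at this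
  obtain ⟨i, hi, h0⟩ := this
  rw [Finset.mem_Icc] at hi
  simp at h0
  omega

/-- In the generic Hecke algebra, where the parameter is the variable of `ℤ[X]`, the quotient
`B_{n,k}^* B_{n,k} / [k]!_q` exists and is unique. -/
theorem existsUnique_smul_eq (n k : ℕ) : ∃! x : Hecke (X : ℤ[X]) n,
    qFactorial (X : ℤ[X]) k • x = randomToBottom X n k * bottomToRandom X n k := by
  obtain ⟨x, hx⟩ := exists_smul_eq (X : ℤ[X]) n k
  exact ⟨x, hx, fun y hy => smul_right_injective _ (qFactorial_X_ne_zero k) (hy.trans hx.symm)⟩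

/-- The `k`-random-to-random shuffle `R_{n,k} = (1 / [k]!_q) B_{n,k}^* B_{n,k}` for an
indeterminate `q`, in the Hecke algebra over `ℤ[q]`. -/
noncomputable def genericRandomToRandom (n k : ℕ) : Hecke (X : ℤ[X]) n :=
  (existsUnique_smul_eq n k).choose

/-- The `k`-random-to-random shuffle `R_{n,k}` of `H_n(q)` over a commutative ring `R`, for
arbitrary `q ∈ R`: the generic one with `q` substituted for the indeterminate. -/
noncomputable def randomToRandom (q : R) (n k : ℕ) : Hecke q n :=
  baseChange (aeval q : ℤ[X] →ₐ[ℤ] R).toRingHom X q (aeval_X q) n (genericRandomToRandom n k)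

theorem baseChange_T {S : Type*} [CommRing S] (f : R →+* S) (q : R) (q' : S) (h : f q = q')
    (n i : ℕ) : baseChange f q q' h n (T q n i) = T q' n i := by
  by_cases hi : i ∈ Finset.Ico 1 n
  · have h' := Finset.mem_Ico.1 hi
    let _ : Algebra R (Hecke q' n) := Algebra.compHom (Hecke q' n) f
    exact lift_T q n _ _ _ _ h'.1 h'.2
  · rw [T_eq_zero q hi, T_eq_zero q' hi, map_zero]

theorem baseChange_smul {S : Type*} [CommRing S] (f : R →+* S) (q : R) (q' : S) (h : f q = q')
    (n : ℕ) (c : R) (x : Hecke q n) :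
    baseChange f q q' h n (c • x) = f c • baseChange f q q' h n x := by
  let _ : Algebra R (Hecke q' n) := Algebra.compHom (Hecke q' n) f
  have : baseChange f q q' h n (algebraMap R _ c) = algebraMap S _ (f c) :=
    (lift q n _ _ _ _).commutes c
  rw [Algebra.smul_def, map_mul, this, Algebra.smul_def]

theorem baseChange_Bk {S : Type*} [CommRing S] (f : R →+* S) (q : R) (q' : S) (h : f q = q')
    (n m k : ℕ) : baseChange f q q' h n (Bk q n m k) = Bk q' n m k := by
  have hB : ∀ m, baseChange f q q' h n (B q n m) = B q' n m := by
    intro m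
    induction m with
    | zero => rw [B_zero, B_zero, map_zero]
    | succ m ih => rw [B_succ, B_succ, map_add, map_one, map_mul, ih, baseChange_T]
  rw [Bk, Bk, map_list_prod, List.map_map]
  congr 2
  funext j
  exact hB _

theorem baseChange_hstar {S : Type*} [CommRing S] (f : R →+* S) (q : R) (q' : S) (h : f q = q')
    (n : ℕ) (a : Hecke q n) :
    baseChange f q q' h n (hstar a) = hstar (baseChange f q q' h n a) := by
  have ha : a ∈ Algebra.adjoin R {x | ∃ i, 1 ≤ i ∧ i < n ∧ x = T q n i} := by
    rw [adjoin_T]; trivial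
  induction ha using Algebra.adjoin_induction with
  | mem x hx =>
    obtain ⟨i, _, _, rfl⟩ := hx
    rw [hstar_T, baseChange_T, hstar_T]
  | algebraMap r =>
    have : ∀ r, baseChange f q q' h n (algebraMap R _ r) = algebraMap S _ (f r) := by
      intro r
      rw [Algebra.algebraMap_eq_smul_one, baseChange_smul, map_one, Algebra.algebraMap_eq_smul_one]
    have hc : hstar (algebraMap R (Hecke q n) r) = algebraMap R (Hecke q n) r := by
      simp [hstar]
    rw [hc, this]
    simp [hstar]
  | add a b _ _ ha hb => rw [hstar_add, map_add, ha, hb, map_add, hstar_add]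
  | mul a b _ _ ha hb => rw [hstar_mul, map_mul, ha, hb, map_mul, hstar_mul]

/-- The relation `[k]!_q R_{n,k} = B_{n,k}^* B_{n,k}` for every `q`; in particular `R_{n,k}` is
`(1 / [k]!_q) B_{n,k}^* B_{n,k}` whenever `[k]!_q` is invertible. -/
theorem qFactorial_smul_randomToRandom (q : R) (n k : ℕ) :
    qFactorial q k • randomToRandom q n k = randomToBottom q n k * bottomToRandom q n k := by
  have h := (existsUnique_smul_eq n k).choose_spec.1
  have h2 := congrArg
    (baseChange (aeval q : ℤ[X] →ₐ[ℤ] R).toRingHom X q (aeval_X q) n) h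
  have hb := baseChange_Bk (aeval q : ℤ[X] →ₐ[ℤ] R).toRingHom X q (aeval_X q) n n k
  rw [baseChange_smul, map_mul] at h2
  unfold randomToBottom at h2
  rw [baseChange_hstar] at h2
  unfold bottomToRandom at h2
  rw [hb] at h2
  have h3 : (aeval q : ℤ[X] →ₐ[ℤ] R).toRingHom (qFactorial X k) = qFactorial q k := by
    simp [qFactorial, qInt]
  rw [h3] at h2
  exact h2

end Generic
end QShuffle

open Polynomial

namespace QShuffle
-- Commutation relations for Jucys–Murphy elements and shuffles
section Relations

variable {R : Type*} [CommRing R]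

/-! It suffices to treat the generic parameter. A `ℤ[X]`-basis of the generic Hecke algebra maps to
a basis for every `𝕜` and `q`, so the characteristic polynomial over `𝕜` is a specialization of the
generic one (`charpoly_mulRight_baseChange`). The generic one is monic over the integrally closed
domain `ℤ[X]`, hence splits there as soon as it splits over the fraction field. Over that field it
divides a power of any polynomial annihilating `randomToRandom`, so the goal is an annihilating
polynomial that splits.

Write `J_m` for `murphy q n m` and `G_{m,k}` for `gram q n m k`. The key relation
(`exists_B_mul_gram`) is `B_{m+1} G_{m+1,k+1} = (q^(k+1) G_{m,k+1} + (α + β J_m) G_{m,k}) B_{m+1}`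
with scalars `α`, `β`. Take a combination `x` of the `G_{m+1,j}` with coefficients in the algebra
generated by the `J_i`, `i ≥ m+1`. Then `B_{m+1} x = y B_{m+1}` with `y` of the same kind at level
`m`. Also, `G_{m+1,j}` is a left multiple of `B_{m+1}` for `j > 0`, so `x = f + g B_{m+1}` with `f`
a polynomial in Jucys–Murphy elements. If `p(f) = 0` and `r(y) = 0`, then `p(x) = c B_{m+1}` for
some `c`, and `p(x) r(x) = c r(y) B_{m+1} = 0`. Induction on `m`
(`hasSplitAnnihilator_of_mem_gramSpan`) leaves only polynomials in the commuting `J_i`, and these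
are handled by intertwiners as in the affine Hecke algebra (`hasSplitAnnihilator_murphy`). -/

theorem T_zero (q : R) (n : ℕ) : T q n 0 = 0 := T_eq_zero q (by simp)

/-- The multiplicative Jucys–Murphy element `T_m ⋯ T_1 T_1 ⋯ T_m`. -/
def murphy (q : R) (n : ℕ) : ℕ → Hecke q n
  | 0 => 1
  | m + 1 => T q n (m + 1) * murphy q n m * T q n (m + 1)

theorem T_comm_murphy_of_lt (q : R) (n : ℕ) {m j : ℕ} (h : m + 1 < j) :
    T q n j * murphy q n m = murphy q n m * T q n j := by
  induction m with
  | zero => simp [murphy]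
  | succ m ih =>
    have hc := T_comm q n h
    rw [murphy, ← mul_assoc, ← mul_assoc, ← hc, mul_assoc (T q n (m + 1)), ih (by omega)]
    simp only [mul_assoc, hc]

/-- Only the case `j + 1 = m` needs the braid relation: it is used once to move `T_j` inwards and
once to bring it out on the other side. -/
theorem T_comm_murphy_of_gt (q : R) (n : ℕ) {m j : ℕ} (h : j < m) :
    T q n j * murphy q n m = murphy q n m * T q n j := by
  induction m with
  | zero => omega
  | succ m ih =>
    rcases Nat.lt_or_ge j m with hj | hj
    · have hc := T_comm q n (show j + 1 < m + 1 by omega)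
      rw [murphy, ← mul_assoc, ← mul_assoc, hc, mul_assoc (T q n (m + 1)), ih hj]
      simp only [mul_assoc, hc]
    · obtain rfl : j = m := by omega
      rcases j with _ | j
      · simp [T_zero]
      by_cases hn : j + 1 + 1 < n
      · have hb := T_braid q (show 1 ≤ j + 1 by omega) hn
        have hc := T_comm_murphy_of_lt q n (show j + 1 < j + 1 + 1 by omega)
        simp only [murphy]
        generalize T q n (j + 1) = t at *
        generalize T q n (j + 1 + 1) = u at *
        generalize murphy q n j = x at *
        calc t * (u * (t * x * t) * u) = (t * u * t) * x * t * u := by simp only [mul_assoc]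
          _ = u * t * (u * x) * t * u := by rw [hb]; simp only [mul_assoc]
          _ = u * t * x * (u * t * u) := by rw [hc]; simp only [mul_assoc]
          _ = _ := by rw [← hb]; simp only [mul_assoc]
      -- Outside the range of generators `T` is `0`, and both sides vanish.
      · have : T q n (j + 1 + 1) = 0 := T_eq_zero q (by simp; omega)
        simp [murphy, this]

/-- `B_m` is a polynomial in `T_1, …, T_{m-1}`; including `j = 0` in the hypothesis costs nothing,
as `T_0 = 0`. -/
theorem B_comm_of_forall_T_comm {q : R} {n m : ℕ} {a : Hecke q n}
    (h : ∀ j < m, T q n j * a = a * T q n j) : B q n m * a = a * B q n m := by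
  induction m with
  | zero => simp [B_zero]
  | succ m ih =>
    rw [B_succ, add_mul, mul_add, mul_assoc, ih fun j hj => h j (by omega), ← mul_assoc,
      h m (by omega), mul_assoc]
    simp

theorem hstar_B_comm_of_forall_T_comm {q : R} {n m : ℕ} {a : Hecke q n}
    (h : ∀ j < m, T q n j * a = a * T q n j) : hstar (B q n m) * a = a * hstar (B q n m) := by
  have := B_comm_of_forall_T_comm (a := hstar a) (m := m) fun j hj => by
    have := congrArg hstar (h j hj)
    rw [hstar_mul, hstar_mul, hstar_T] at this
    exact this.symm
  have := congrArg hstar this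
  rw [hstar_mul, hstar_mul, hstar_hstar] at this
  exact this.symm

theorem murphy_comm_murphy (q : R) (n i j : ℕ) :
    murphy q n i * murphy q n j = murphy q n j * murphy q n i := by
  wlog h : i ≤ j generalizing i j
  · exact (this j i (by omega)).symm
  rcases h.eq_or_lt with rfl | h
  · rfl
  induction i with
  | zero => simp [murphy]
  | succ i ih =>
    have hc := T_comm_murphy_of_gt q n h
    rw [murphy, mul_assoc, hc, mul_assoc, ← mul_assoc (murphy q n i), ih (by omega) (by omega),
      ← mul_assoc, ← mul_assoc, hc]
    simp only [mul_assoc]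

/-- The unnormalized random-to-random shuffle `B_{m,k}^* B_{m,k}`. -/
def gram (q : R) (n : ℕ) : ℕ → ℕ → Hecke q n
  | _, 0 => 1
  | 0, _ + 1 => 0
  | m + 1, k + 1 => hstar (B q n (m + 1)) * gram q n m k * B q n (m + 1)

theorem gram_succ_succ (q : R) (n m k : ℕ) : gram q n (m + 1) (k + 1) =
    hstar (B q n (m + 1)) * gram q n m k * B q n (m + 1) := rfl

theorem gram_zero_right (q : R) (n m : ℕ) : gram q n m 0 = 1 := by cases m <;> rfl

theorem gram_one (q : R) (n m : ℕ) : gram q n m 1 = hstar (B q n m) * B q n m := by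
  cases m <;> simp [gram, gram_zero_right, B_zero]

theorem gram_eq (q : R) (n m k : ℕ) : gram q n m k = hstar (Bk q n m k) * Bk q n m k := by
  induction k generalizing m with
  | zero => simp [gram_zero_right, Bk, hstar_one]
  | succ k ih =>
    cases m with
    | zero => simp [gram, Bk_eq_zero]
    | succ m =>
      rw [Bk_succ, hstar_mul, gram, ih, Nat.add_sub_cancel]
      simp only [mul_assoc]

theorem gram_comm_of_forall_T_comm {q : R} {n m : ℕ} (k : ℕ) {a : Hecke q n}
    (h : ∀ j < m, T q n j * a = a * T q n j) : gram q n m k * a = a * gram q n m k := by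
  induction m generalizing k with
  | zero => cases k <;> simp [gram]
  | succ m ih =>
    cases k with
    | zero => simp [gram]
    | succ k =>
      rw [gram, mul_assoc, B_comm_of_forall_T_comm h, mul_assoc, ← mul_assoc (gram q n m k),
        ih k fun j hj => h j (by omega), ← mul_assoc, ← mul_assoc, ← mul_assoc,
        hstar_B_comm_of_forall_T_comm h]
      simp only [mul_assoc]

end Relations

/-! ### Moving `B` past the unnormalized shuffles -/

section FieldRelations

variable {K : Type*} [Field K]

/-- Expand both factors by `B_{m+1} = 1 + T_m B_m` and conjugate the inductive formula by the new
generator. The Jucys–Murphy term reproduces itself, since `murphy` is defined by this conjugation.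
-/
theorem B_mul_hstar_B {q : K} (hq : q ≠ 1) {n m : ℕ} (h : m + 1 ≤ n) :
    B q n (m + 1) * hstar (B q n (m + 1)) =
      hstar (B q n m) * T q n m * B q n m + (q - 1)⁻¹ • (q • murphy q n m - 1) := by
  have hq' : q - 1 ≠ 0 := sub_ne_zero.2 hq
  induction m with
  | zero =>
    have : q • (1 : Hecke q n) - 1 = (q - 1) • 1 := by rw [sub_smul, one_smul]
    simp [B_succ, B_zero, hstar_one, murphy, this, smul_smul, hq']
  | succ m ih =>
    have ih := ih (by omega)
    have ht := T_sq q (show 1 ≤ m + 1 by omega) (show m + 1 < n by omega)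
    have hB : hstar (B q n (m + 1 + 1)) = 1 + hstar (B q n (m + 1)) * T q n (m + 1) := by
      rw [B_succ q n (m + 1), hstar_add, hstar_one, hstar_mul, hstar_T]
    have hc : T q n (m + 1) * hstar (B q n m) = hstar (B q n m) * T q n (m + 1) :=
      (hstar_B_comm_of_forall_T_comm fun j hj => T_comm q n (by omega)).symm
    have hc' := T_comm_B q n (show m < m + 1 by omega)
    -- The outer generators commute past `B_m` and its star, and the braid relation swaps the roles
    -- of `T_m` and `T_{m+1}`. For `m = 0` both sides are `0`.
    have hb : T q n (m + 1) * (hstar (B q n m) * T q n m * B q n m) * T q n (m + 1) =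
        (hstar (B q n (m + 1)) - 1) * T q n (m + 1) * (B q n (m + 1) - 1) := by
      have e1 : B q n (m + 1) - 1 = T q n m * B q n m := by rw [B_succ]; abel
      have e2 : hstar (B q n (m + 1)) - 1 = hstar (B q n m) * T q n m := by
        rw [B_succ, hstar_add, hstar_one, hstar_mul, hstar_T]; abel
      rw [e1, e2]
      have hbr : T q n (m + 1) * T q n m * T q n (m + 1) = T q n m * T q n (m + 1) * T q n m := by
        rcases Nat.eq_zero_or_pos m with rfl | hm
        · simp [T_zero]
        · exact (T_braid q hm (by omega)).symm
      generalize hstar (B q n m) = s at *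
      generalize B q n m = c at *
      generalize T q n (m + 1) = t at *
      generalize T q n m = u at *
      calc t * (s * u * c) * t = (t * s) * u * (c * t) := by simp only [mul_assoc]
        _ = s * (t * u * t) * c := by rw [hc, ← hc']; simp only [mul_assoc]
        _ = _ := by rw [hbr]; simp only [mul_assoc]
    have e : T q n (m + 1) * (B q n (m + 1) * hstar (B q n (m + 1))) * T q n (m + 1) =
        (hstar (B q n (m + 1)) - 1) * T q n (m + 1) * (B q n (m + 1) - 1) +
          (q - 1)⁻¹ • (q • murphy q n (m + 1) - T q n (m + 1) * T q n (m + 1)) := by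
      rw [ih, mul_add, add_mul, hb, murphy]
      simp only [mul_smul_comm, smul_mul_assoc, mul_sub, sub_mul, mul_one]
    rw [hB, B_succ q n (m + 1)]
    have e' : (1 + T q n (m + 1) * B q n (m + 1)) *
        (1 + hstar (B q n (m + 1)) * T q n (m + 1)) =
        1 + T q n (m + 1) * B q n (m + 1) + hstar (B q n (m + 1)) * T q n (m + 1) +
        T q n (m + 1) * (B q n (m + 1) * hstar (B q n (m + 1))) * T q n (m + 1) := by
      simp only [mul_add, add_mul, mul_one, one_mul, mul_assoc]
      abel
    rw [e', e, ht, Algebra.algebraMap_eq_smul_one]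
    generalize hstar (B q n (m + 1)) = s at *
    generalize B q n (m + 1) = b at *
    generalize T q n (m + 1) = t at *
    simp only [sub_mul, mul_sub, one_mul, mul_one]
    match_scalars <;> field_simp <;> ring

/-- Multiply `J_{m+1} = T_{m+1} J_m T_{m+1}` by `T_{m+1}`, apply the quadratic relation and solve
for the product, which needs `q ≠ 0`. -/
theorem T_mul_murphy {q : K} (hq : q ≠ 0) {n m : ℕ} (h : m + 1 < n) :
    T q n (m + 1) * murphy q n m =
      q⁻¹ • (murphy q n (m + 1) * T q n (m + 1) - (q - 1) • murphy q n (m + 1)) := by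
  rw [murphy, mul_assoc _ _ (T q n (m + 1)), T_sq q (by omega) h,
    Algebra.algebraMap_eq_smul_one]
  simp only [mul_add, mul_smul_comm, mul_one]
  match_scalars <;> field_simp <;> ring

theorem murphy_mul_T {q : K} (hq : q ≠ 0) {n m : ℕ} (h : m + 1 < n) :
    murphy q n m * T q n (m + 1) =
      q⁻¹ • (T q n (m + 1) * murphy q n (m + 1) - (q - 1) • murphy q n (m + 1)) := by
  rw [murphy, ← mul_assoc, ← mul_assoc, T_sq q (by omega) h,
    Algebra.algebraMap_eq_smul_one]
  simp only [add_mul, smul_mul_assoc, one_mul]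
  match_scalars <;> field_simp <;> ring

theorem T_mul_B_mul_B_of_lt (q : K) {n m : ℕ} (h : m < n) :
    T q n m * (B q n m * B q n (m + 1)) = q • (B q n m * B q n (m + 1)) := by
  rcases Nat.eq_zero_or_pos m with rfl | hm
  · simp [B_zero]
  · exact T_mul_B_mul_B q hm h

/-- Rewrite the leading `B_{m+1} B_{m+1}^*` by `B_mul_hstar_B`. The generator `T_m` that appears is
moved right until it meets `B_m B_{m+1}`, which absorbs it as the scalar `q`. -/
theorem exists_B_mul_gram {q : K} (hq0 : q ≠ 0) (hq : q ≠ 1) {n m : ℕ} (k : ℕ) (h : m + 1 ≤ n) :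
    ∃ α β : K, B q n (m + 1) * gram q n (m + 1) (k + 1) =
      (q ^ (k + 1) • gram q n m (k + 1) + (α • 1 + β • murphy q n m) * gram q n m k) *
        B q n (m + 1) := by
  induction k generalizing m with
  | zero =>
    refine ⟨-(q - 1)⁻¹, (q - 1)⁻¹ * q, ?_⟩
    have hT := T_mul_B_mul_B_of_lt q (show m < n by omega)
    rw [gram_one, gram_one, gram_zero_right, ← mul_assoc, B_mul_hstar_B hq h]
    simp only [add_mul, smul_mul_assoc, sub_mul, mul_assoc, hT, one_mul, mul_one, mul_smul_comm]
    module
  | succ k ih =>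
    have hB := B_mul_hstar_B hq h
    rcases m with _ | m
    -- Both sides vanish, because `gram q n 0` is `0` in positive degree.
    · refine ⟨0, 0, ?_⟩
      simp [gram]
    obtain ⟨α, β, ih⟩ := ih (m := m) (by omega)
    -- The factors `q` and `q⁻¹` come from `e1` and `e2`; the added constants come from the term `(q
    -- J_{m+1} - 1) / (q - 1)` of `B_mul_hstar_B`.
    refine ⟨q * α - (q - 1)⁻¹, q⁻¹ * β + (q - 1)⁻¹ * q, ?_⟩
    have hT := T_mul_B_mul_B_of_lt q (show m + 1 < n by omega)
    have hTm := T_mul_murphy hq0 (show m + 1 < n by omega)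
    have hTg : ∀ k, T q n (m + 1) * gram q n m k = gram q n m k * T q n (m + 1) := fun k =>
      (gram_comm_of_forall_T_comm k fun j hj => T_comm q n (by omega)).symm
    have hs : hstar (B q n (m + 1)) * murphy q n (m + 1) =
        murphy q n (m + 1) * hstar (B q n (m + 1)) :=
      hstar_B_comm_of_forall_T_comm fun j hj => T_comm_murphy_of_gt q n hj
    have e1 : ∀ k, T q n (m + 1) * (gram q n m k * (B q n (m + 1) * B q n (m + 1 + 1))) =
        q • (gram q n m k * (B q n (m + 1) * B q n (m + 1 + 1))) := fun k => by
      rw [← mul_assoc, hTg, mul_assoc, hT, mul_smul_comm]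
    -- In `T_mul_murphy` the last `T` acts as `q`, so `q⁻¹ (q - (q - 1)) = q⁻¹` remains.
    have e2 : T q n (m + 1) * (murphy q n m * (gram q n m k *
        (B q n (m + 1) * B q n (m + 1 + 1)))) =
        q⁻¹ • (murphy q n (m + 1) * (gram q n m k * (B q n (m + 1) * B q n (m + 1 + 1)))) := by
      rw [← mul_assoc, hTm, smul_mul_assoc, sub_mul, mul_assoc, e1, smul_mul_assoc, mul_smul_comm]
      module
    have e3 : hstar (B q n (m + 1)) * T q n (m + 1) * B q n (m + 1) * gram q n (m + 1) (k + 1) *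
        B q n (m + 1 + 1) = (q ^ (k + 2) • gram q n (m + 1) (k + 2) + ((q * α) • 1 +
          (q⁻¹ * β) • murphy q n (m + 1)) * gram q n (m + 1) (k + 1)) * B q n (m + 1 + 1) := by
      rw [mul_assoc _ (B q n (m + 1)), ih]
      rw [gram_succ_succ, gram_succ_succ]
      simp only [add_mul, mul_add, smul_mul_assoc, mul_smul_comm, mul_assoc, one_mul, e1, e2]
      rw [← mul_assoc (hstar (B q n (m + 1))) (murphy q n (m + 1)), hs, mul_assoc]
      module
    rw [gram_succ_succ q n (m + 1), ← mul_assoc, ← mul_assoc, hB,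
      add_mul, add_mul, e3]
    simp only [add_mul, smul_mul_assoc, sub_mul, one_mul]
    module

end FieldRelations

universe u

/-! ### Elements annihilated by split polynomials -/

section SplitAnnihilator

variable {K : Type*} [Field K]

/-- An element of a `K`-algebra that is annihilated by a nonzero polynomial which splits over
`K`. -/
def HasSplitAnnihilator (K : Type*) [Field K] {A : Type*} [Ring A] [Algebra K A] (a : A) : Prop :=
  ∃ p : K[X], p ≠ 0 ∧ p.Splits ∧ aeval a p = 0

/-- In the commutative case the condition says that `a` takes finitely many values, all in `K`, on
the spectrum. This makes closure under ring operations evident. Conversely, the product of the `a -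
s` lies in every prime ideal, so it is nilpotent and a power of `∏ (X - s)` annihilates `a`. -/
theorem hasSplitAnnihilator_iff_forall_isPrime {A : Type*} [CommRing A] [Algebra K A] {a : A} :
    HasSplitAnnihilator K a ↔
      ∃ S : Finset K, ∀ P : Ideal A, P.IsPrime → ∃ s ∈ S, a - algebraMap K A s ∈ P := by
  classical
  constructor
  · rintro ⟨p, hp0, hp, ha⟩
    refine ⟨p.roots.toFinset, fun P hP => ?_⟩
    rw [hp.eq_prod_roots, map_mul, aeval_C, map_multiset_prod, Multiset.map_map] at ha
    have hu : IsUnit (algebraMap K A p.leadingCoeff) :=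
      (isUnit_iff_ne_zero.2 (leadingCoeff_ne_zero.2 hp0)).map _
    rw [hu.mul_right_eq_zero] at ha
    have h0 : (p.roots.map (aeval a ∘ fun r => X - C r)).prod ∈ P := ha ▸ P.zero_mem
    obtain ⟨x, hx, hxP⟩ := (Ideal.IsPrime.multiset_prod_mem_iff_exists_mem hP _).1 h0
    obtain ⟨r, hr, rfl⟩ := Multiset.mem_map.1 hx
    exact ⟨r, Multiset.mem_toFinset.2 hr, by simpa using hxP⟩
  · rintro ⟨S, hS⟩
    have hnil : IsNilpotent (∏ s ∈ S, (a - algebraMap K A s)) := by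
      rw [← mem_nilradical, nilradical_eq_sInf, Submodule.mem_sInf]
      intro P hP
      obtain ⟨s, hs, hsP⟩ := hS P hP
      exact Ideal.mem_of_dvd P (Finset.dvd_prod_of_mem _ hs) hsP
    obtain ⟨N, hN⟩ := hnil
    refine ⟨(∏ s ∈ S, (X - C s)) ^ N, pow_ne_zero _ (Finset.prod_ne_zero_iff.2
      fun s _ => X_sub_C_ne_zero s), (Splits.prod fun s _ => Splits.X_sub_C s).pow N, ?_⟩
    simpa using hN

theorem hasSplitAnnihilator_map_iff {A H : Type*} [Ring A] [Algebra K A] [Ring H] [Algebra K H]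
    (f : A →ₐ[K] H) (hf : Function.Injective f) {a : A} :
    HasSplitAnnihilator K (f a) ↔ HasSplitAnnihilator K a := by
  simp only [HasSplitAnnihilator, aeval_algHom_apply, map_eq_zero_iff f hf]

variable {H : Type*} [Ring H] [Algebra K H]

theorem HasSplitAnnihilator.add_of_commRing {A : Type*} [CommRing A] [Algebra K A] {x y : A}
    (hx : HasSplitAnnihilator K x) (hy : HasSplitAnnihilator K y) :
    HasSplitAnnihilator K (x + y) := by
  classical
  rw [hasSplitAnnihilator_iff_forall_isPrime] at hx hy ⊢
  obtain ⟨S, hS⟩ := hx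
  obtain ⟨U, hU⟩ := hy
  refine ⟨Finset.image₂ (· + ·) S U, fun P hP => ?_⟩
  obtain ⟨s, hs, hsP⟩ := hS P hP
  obtain ⟨u, hu, huP⟩ := hU P hP
  refine ⟨s + u, Finset.mem_image₂_of_mem hs hu, ?_⟩
  convert P.add_mem hsP huP using 1
  rw [map_add]
  ring

theorem HasSplitAnnihilator.mul_of_commRing {A : Type*} [CommRing A] [Algebra K A] {x y : A}
    (hx : HasSplitAnnihilator K x) (hy : HasSplitAnnihilator K y) :
    HasSplitAnnihilator K (x * y) := by
  classical
  rw [hasSplitAnnihilator_iff_forall_isPrime] at hx hy ⊢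
  obtain ⟨S, hS⟩ := hx
  obtain ⟨U, hU⟩ := hy
  refine ⟨Finset.image₂ (· * ·) S U, fun P hP => ?_⟩
  obtain ⟨s, hs, hsP⟩ := hS P hP
  obtain ⟨u, hu, huP⟩ := hU P hP
  refine ⟨s * u, Finset.mem_image₂_of_mem hs hu, ?_⟩
  convert P.add_mem (P.mul_mem_left x huP) (P.mul_mem_right (algebraMap K A u) hsP) using 1
  rw [map_mul]
  ring

open scoped IsMulCommutative in
/-- The subalgebra generated by commuting elements, as the range of an embedding of a commutative
ring. -/
theorem exists_commRing_range_eq_adjoin {K : Type*} [Field K] {H : Type u} [Ring H] [Algebra K H]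
    {s : Set H} (hcomm : ∀ a ∈ s, ∀ b ∈ s, a * b = b * a) :
    ∃ (A : Type u) (_ : CommRing A) (_ : Algebra K A) (f : A →ₐ[K] H),
      Function.Injective f ∧ f.range = Algebra.adjoin K s :=
  have := Algebra.isMulCommutative_adjoin K hcomm
  ⟨Algebra.adjoin K s, inferInstance, inferInstance, (Algebra.adjoin K s).val,
    Subtype.val_injective, Subalgebra.range_val _⟩

/-- Commuting generators span a commutative subalgebra, where values on primes can be added and
multiplied. -/
theorem HasSplitAnnihilator.of_mem_adjoin {s : Set H} (hcomm : ∀ a ∈ s, ∀ b ∈ s, a * b = b * a)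
    (hs : ∀ a ∈ s, HasSplitAnnihilator K a) {a : H} (ha : a ∈ Algebra.adjoin K s) :
    HasSplitAnnihilator K a := by
  obtain ⟨A, _, _, f, hf, hr⟩ := exists_commRing_range_eq_adjoin (K := K) hcomm
  have hval : ∀ x ∈ Algebra.adjoin K s, ∃ y, f y = x := fun x hx => by
    rw [← hr] at hx; exact hx
  induction ha using Algebra.adjoin_induction with
  | mem x hx => exact hs x hx
  | algebraMap r => exact ⟨X - C r, X_sub_C_ne_zero r, Splits.X_sub_C r, by simp⟩
  | add x y hx hy ihx ihy =>
    obtain ⟨x, rfl⟩ := hval x hx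
    obtain ⟨y, rfl⟩ := hval y hy
    rw [← map_add]
    rw [hasSplitAnnihilator_map_iff f hf] at ihx ihy ⊢
    exact ihx.add_of_commRing ihy
  | mul x y hx hy ihx ihy =>
    obtain ⟨x, rfl⟩ := hval x hx
    obtain ⟨y, rfl⟩ := hval y hy
    rw [← map_mul]
    rw [hasSplitAnnihilator_map_iff f hf] at ihx ihy ⊢
    exact ihx.mul_of_commRing ihy

/-- Modulo a prime one factor vanishes, so the value of `b` is a root of `p`, or `c` times a value
of `a`, or a value of `a`. -/
theorem HasSplitAnnihilator.of_aeval_mul_eq_zero_of_commRing {A : Type*} [CommRing A] [Algebra K A]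
    {a b : A} (ha : HasSplitAnnihilator K a) {p : K[X]} (hp0 : p ≠ 0) (hp : p.Splits) {c : K}
    (h : aeval b p * ((c • a - b) * (a - b)) = 0) : HasSplitAnnihilator K b := by
  classical
  rw [hasSplitAnnihilator_iff_forall_isPrime] at ha ⊢
  obtain ⟨S, hS⟩ := ha
  refine ⟨p.roots.toFinset ∪ (S ∪ S.image (c * ·)), fun P hP => ?_⟩
  obtain ⟨s, hs, hsP⟩ := hS P hP
  have h0 : aeval b p * ((c • a - b) * (a - b)) ∈ P := h ▸ P.zero_mem
  rcases hP.mem_or_mem h0 with h1 | h1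
  · rw [hp.eq_prod_roots, map_mul, aeval_C, map_multiset_prod, Multiset.map_map] at h1
    have hu : IsUnit (algebraMap K A p.leadingCoeff) :=
      (isUnit_iff_ne_zero.2 (leadingCoeff_ne_zero.2 hp0)).map _
    rw [Ideal.unit_mul_mem_iff_mem _ hu, Ideal.IsPrime.multiset_prod_mem_iff_exists_mem hP] at h1
    obtain ⟨x, hx, hxP⟩ := h1
    obtain ⟨r, hr, rfl⟩ := Multiset.mem_map.1 hx
    exact ⟨r, Finset.mem_union_left _ (Multiset.mem_toFinset.2 hr), by simpa using hxP⟩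
  rcases hP.mem_or_mem h1 with h1 | h1
  · refine ⟨c * s, Finset.mem_union_right _ (Finset.mem_union_right _
      (Finset.mem_image_of_mem _ hs)), ?_⟩
    convert P.sub_mem (P.mul_mem_left (algebraMap K A c) hsP) h1 using 1
    rw [map_mul, Algebra.smul_def]
    ring
  · refine ⟨s, Finset.mem_union_right _ (Finset.mem_union_left _ hs), ?_⟩
    convert P.sub_mem hsP h1 using 1
    ring

theorem HasSplitAnnihilator.of_aeval_mul_eq_zero {a b : H} (hab : a * b = b * a)
    (ha : HasSplitAnnihilator K a) {p : K[X]} (hp0 : p ≠ 0) (hp : p.Splits) {c : K}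
    (h : aeval b p * ((c • a - b) * (a - b)) = 0) : HasSplitAnnihilator K b := by
  have hcomm : ∀ x ∈ ({a, b} : Set H), ∀ y ∈ ({a, b} : Set H), x * y = y * x := by
    rintro x (rfl | rfl) y (rfl | rfl)
    exacts [rfl, hab, hab.symm, rfl]
  obtain ⟨A, _, _, f, hf, hr⟩ := exists_commRing_range_eq_adjoin (K := K) hcomm
  have hval : ∀ x ∈ ({a, b} : Set H), ∃ y, f y = x := fun x hx => by
    have := Algebra.subset_adjoin (R := K) hx
    rw [← hr] at this; exact this
  obtain ⟨a, rfl⟩ := hval a (by simp)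
  obtain ⟨b, rfl⟩ := hval b (by simp)
  rw [hasSplitAnnihilator_map_iff f hf] at ha ⊢
  refine ha.of_aeval_mul_eq_zero_of_commRing hp0 hp (c := c) (hf ?_)
  rw [map_mul, map_mul, map_sub, map_sub, map_smul, map_zero, ← aeval_algHom_apply]
  exact h

theorem mul_aeval_eq_aeval_mul {a x y : H} (h : a * x = y * a) (p : K[X]) :
    a * aeval x p = aeval y p * a := by
  induction p using Polynomial.induction_on' with
  | add p r hp hr => rw [map_add, map_add, mul_add, add_mul, hp, hr]
  | monomial i c =>
    rw [aeval_monomial, aeval_monomial, ← mul_assoc, ← Algebra.commutes, mul_assoc, mul_assoc]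
    congr 1
    exact (SemiconjBy.pow_right (show SemiconjBy a x y from h) i).eq

/-- Since `f` commutes with `b`, the left ideal `H b` is stable under right multiplication by `f`,
hence by `f + g b`; powers can therefore be computed modulo `H b`. -/
theorem exists_aeval_add_mul_eq {f g b : H} (h : f * b = b * f) (p : K[X]) :
    ∃ c, aeval (f + g * b) p = aeval f p + c * b := by
  induction p using Polynomial.induction_on' with
  | add p r hp hr =>
    obtain ⟨c, hc⟩ := hp
    obtain ⟨d, hd⟩ := hr
    exact ⟨c + d, by rw [map_add, map_add, hc, hd, add_mul]; abel⟩
  | monomial i r =>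
    obtain ⟨c, hc⟩ : ∃ c, (f + g * b) ^ i = f ^ i + c * b := by
      induction i with
      | zero => exact ⟨0, by simp⟩
      | succ i ih =>
        obtain ⟨c, hc⟩ := ih
        refine ⟨f ^ i * g + c * f + c * b * g, ?_⟩
        rw [pow_succ, hc, pow_succ]
        simp only [mul_add, add_mul, mul_assoc, h]
        abel
    exact ⟨algebraMap K H r * c, by
      rw [aeval_monomial, aeval_monomial, hc, mul_add, mul_assoc]⟩

/-- If `b` intertwines `x` and `y` and `x` acts modulo `b` as an element `f` that commutes with
`b`, then split annihilators of `f` and `y` give one of `x`. -/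
theorem HasSplitAnnihilator.of_intertwining {b f g x y : H} (hx : x = f + g * b)
    (hf : f * b = b * f) (hxy : b * x = y * b) (h1 : HasSplitAnnihilator K f)
    (h2 : HasSplitAnnihilator K y) : HasSplitAnnihilator K x := by
  obtain ⟨p, hp0, hp, hpf⟩ := h1
  obtain ⟨r, hr0, hr, hry⟩ := h2
  refine ⟨p * r, mul_ne_zero hp0 hr0, hp.mul hr, ?_⟩
  obtain ⟨c, hc⟩ := exists_aeval_add_mul_eq (g := g) hf p
  rw [map_mul, hx, hc, hpf, zero_add, mul_assoc, ← hx, mul_aeval_eq_aeval_mul hxy, hry, zero_mul,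
    mul_zero]

end SplitAnnihilator

/-! ### Split annihilators of Jucys–Murphy elements and of the shuffles -/

section SplitMurphy

variable {K : Type*} [Field K]

/-- With `M = J_m` and `N = J_{m+1}`, an intertwiner `φ` satisfies `φ M = q⁻¹ N φ`, and `φ²` is a
nonzero scalar multiple of `(q² M - N)(M - N)`. Thus every value of `N` is `q` times a root of the
annihilator of `M`, or `q²` times a value of `M`, or a value of `M`. -/
theorem hasSplitAnnihilator_murphy {q : K} (hq0 : q ≠ 0) (n m : ℕ) :
    HasSplitAnnihilator K (murphy q n m) := by
  induction m with
  | zero => exact ⟨X - C 1, X_sub_C_ne_zero 1, Splits.X_sub_C 1, by simp [murphy]⟩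
  | succ m ih =>
    by_cases h : m + 1 < n
    · have hMT := murphy_mul_T hq0 h
      have hTM := T_mul_murphy hq0 h
      have hTT := T_sq q (show 1 ≤ m + 1 by omega) h
      have hMN := murphy_comm_murphy q n m (m + 1)
      rw [Algebra.algebraMap_eq_smul_one] at hTT
      obtain ⟨p, hp0, hp, hpM⟩ := ih
      -- The polynomial `p(q⁻¹ X)` is chosen so that `p(q⁻¹ N) φ² = φ p(M) φ = 0`.
      refine HasSplitAnnihilator.of_aeval_mul_eq_zero hMN ⟨p, hp0, hp, hpM⟩
        (p := p.comp (C q⁻¹ * X)) (c := q ^ 2) ?_ ?_ ?_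
      -- Substituting `q X` undoes the rescaling and would give `p = 0`.
      · intro h0
        have := congrArg (fun r => r.comp (C q * X)) h0
        simp only [comp_assoc, mul_comp, C_comp, X_comp, ← mul_assoc, ← C_mul] at this
        simp [hq0] at this
        exact hp0 this
      · exact hp.comp_of_natDegree_le_one (natDegree_C_mul_le _ _ |>.trans natDegree_X_le)
      · rw [aeval_comp, map_mul, aeval_C, aeval_X, ← Algebra.smul_def]
        generalize murphy q n (m + 1) = N at *
        generalize murphy q n m = M at *
        generalize T q n (m + 1) = t at *
        have hNT : N * t = q • (t * M) + (q - 1) • N := by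
          rw [hTM, smul_smul, mul_inv_cancel₀ hq0]; module
        have hMT' : ∀ x, M * (t * x) = q⁻¹ • (t * (N * x) - (q - 1) • (N * x)) := fun x => by
          rw [← mul_assoc, hMT, smul_mul_assoc, sub_mul, smul_mul_assoc, mul_assoc]
        have hNT' : ∀ x, N * (t * x) = q • (t * (M * x)) + (q - 1) • (N * x) := fun x => by
          rw [← mul_assoc, hNT, add_mul, smul_mul_assoc, smul_mul_assoc, mul_assoc]
        have hTT' : ∀ x, t * (t * x) = (q - 1) • (t * x) + q • x := fun x => by
          rw [← mul_assoc, hTT, add_mul, smul_mul_assoc, smul_mul_assoc, one_mul]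
        -- The intertwiner of the affine Hecke algebra, cleared of denominators.
        set φ := t * (q • M - N) + (q - 1) • N with hφ
        have h1 : φ * M = (q⁻¹ • N) * φ := by
          rw [hφ]
          simp only [mul_add, add_mul, mul_sub, sub_mul, smul_mul_assoc, mul_smul_comm, mul_assoc,
            hNT', ← hMN, smul_add, smul_smul]
          match_scalars <;> field_simp <;> ring
        have h2 : (q ^ 2 • M - N) * (M - N) = (-q⁻¹) • (φ * φ) := by
          rw [hφ]
          simp only [mul_add, add_mul, mul_sub, sub_mul, smul_mul_assoc, mul_smul_comm, mul_assoc,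
            hNT', hMT', hTT', ← hMN, smul_add, smul_sub, smul_smul]
          match_scalars <;> field_simp <;> ring
        rw [h2, mul_smul_comm, ← mul_assoc, ← mul_aeval_eq_aeval_mul h1, hpM]
        simp
    -- Beyond the last generator the Jucys–Murphy element is `0`, annihilated by `X`.
    · have : T q n (m + 1) = 0 := T_eq_zero q (by simp; omega)
      exact ⟨X, X_ne_zero, Splits.X, by simp [murphy, this]⟩

/-- The algebra generated by the Jucys–Murphy elements of index at least `m`. -/
def murphyAlgebra (q : K) (n m : ℕ) : Subalgebra K (Hecke q n) :=
  Algebra.adjoin K (murphy q n '' Set.Ici m)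

theorem murphyAlgebra_anti (q : K) (n : ℕ) {m l : ℕ} (h : m ≤ l) :
    murphyAlgebra q n l ≤ murphyAlgebra q n m :=
  Algebra.adjoin_mono (Set.image_mono (Set.Ici_subset_Ici.2 h))

theorem murphy_mem_murphyAlgebra (q : K) (n m : ℕ) : murphy q n m ∈ murphyAlgebra q n m :=
  Algebra.subset_adjoin ⟨m, Set.self_mem_Ici, rfl⟩

theorem hasSplitAnnihilator_of_mem_murphyAlgebra {q : K} (hq0 : q ≠ 0) {n m : ℕ}
    {a : Hecke q n} (ha : a ∈ murphyAlgebra q n m) : HasSplitAnnihilator K a := by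
  refine HasSplitAnnihilator.of_mem_adjoin ?_ ?_ ha
  · rintro _ ⟨i, _, rfl⟩ _ ⟨j, _, rfl⟩
    exact murphy_comm_murphy q n i j
  · rintro _ ⟨i, _, rfl⟩
    exact hasSplitAnnihilator_murphy hq0 n i

theorem T_comm_of_mem_murphyAlgebra {q : K} {n m j : ℕ} (h : j < m) {a : Hecke q n}
    (ha : a ∈ murphyAlgebra q n m) : T q n j * a = a * T q n j := by
  induction ha using Algebra.adjoin_induction with
  | mem x hx =>
    obtain ⟨i, hi, rfl⟩ := hx
    exact T_comm_murphy_of_gt q n (h.trans_le hi)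
  | algebraMap r => exact (Algebra.commutes r _).symm
  | add a b _ _ ha hb => rw [mul_add, add_mul, ha, hb]
  | mul a b _ _ ha hb => rw [← mul_assoc, ha, mul_assoc, hb, mul_assoc]

/-- The span of the products of an element of `murphyAlgebra q n m` and some `gram q n m j`. -/
def gramSpan (q : K) (n m : ℕ) : Submodule K (Hecke q n) :=
  Submodule.span K {x | ∃ c ∈ murphyAlgebra q n m, ∃ j, x = c * gram q n m j}

theorem mul_gram_mem_gramSpan {q : K} {n m : ℕ} {c : Hecke q n} (hc : c ∈ murphyAlgebra q n m)
    (j : ℕ) : c * gram q n m j ∈ gramSpan q n m :=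
  Submodule.subset_span ⟨c, hc, j, rfl⟩

/-- Base of the descent: `gram q n 0 j` is `1` for `j = 0` and `0` otherwise. -/
theorem mem_murphyAlgebra_of_mem_gramSpan_zero {q : K} {n : ℕ} {x : Hecke q n}
    (hx : x ∈ gramSpan q n 0) : x ∈ murphyAlgebra q n 0 := by
  induction hx using Submodule.span_induction with
  | mem x hx =>
    obtain ⟨c, hc, j, rfl⟩ := hx
    cases j with
    | zero => rwa [gram_zero_right, mul_one]
    | succ j => simp [gram]
  | zero => exact zero_mem _
  | add x y _ _ hx hy => exact add_mem hx hy
  | smul r x _ hx => exact Subalgebra.smul_mem _ hx r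

/-- `gram q n (m + 1) j` ends in `B_{m+1}` unless `j = 0`, so only the terms with `j = 0` survive
modulo the left ideal of `B_{m+1}`. -/
theorem exists_eq_add_mul_B {q : K} {n m : ℕ} {x : Hecke q n} (hx : x ∈ gramSpan q n (m + 1)) :
    ∃ f ∈ murphyAlgebra q n (m + 1), ∃ g, x = f + g * B q n (m + 1) := by
  induction hx using Submodule.span_induction with
  | mem x hx =>
    obtain ⟨c, hc, j, rfl⟩ := hx
    cases j with
    | zero => exact ⟨c, hc, 0, by simp [gram_zero_right]⟩
    | succ j =>
      exact ⟨0, zero_mem _, c * (hstar (B q n (m + 1)) * gram q n m j), by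
        rw [gram_succ_succ, zero_add, mul_assoc c]⟩
  | zero => exact ⟨0, zero_mem _, 0, by simp⟩
  | add x y _ _ hx hy =>
    obtain ⟨f, hf, g, rfl⟩ := hx
    obtain ⟨f', hf', g', rfl⟩ := hy
    exact ⟨f + f', add_mem hf hf', g + g', by rw [add_mul]; abel⟩
  | smul r x _ hx =>
    obtain ⟨f, hf, g, rfl⟩ := hx
    exact ⟨r • f, Subalgebra.smul_mem _ hf r, r • g, by rw [smul_add, smul_mul_assoc]⟩

/-- The coefficients commute with `T_1, …, T_m`, hence with `B_{m+1}`. Moving `B_{m+1}` past `gram`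
creates the new coefficient `J_m`, which is why the coefficient algebra grows as the level drops. -/
theorem exists_B_mul_eq_mul_B {q : K} (hq0 : q ≠ 0) (hq : q ≠ 1) {n m : ℕ} (h : m + 1 ≤ n)
    {x : Hecke q n} (hx : x ∈ gramSpan q n (m + 1)) :
    ∃ y ∈ gramSpan q n m, B q n (m + 1) * x = y * B q n (m + 1) := by
  induction hx using Submodule.span_induction with
  | mem x hx =>
    obtain ⟨c, hc, j, rfl⟩ := hx
    have hcB : B q n (m + 1) * c = c * B q n (m + 1) :=
      B_comm_of_forall_T_comm fun j hj => T_comm_of_mem_murphyAlgebra hj hc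
    have hc' := murphyAlgebra_anti q n (Nat.le_succ m) hc
    rw [← mul_assoc, hcB, mul_assoc]
    cases j with
    | zero =>
      refine ⟨c * gram q n m 0, mul_gram_mem_gramSpan hc' 0, ?_⟩
      rw [gram_zero_right, gram_zero_right, mul_one, mul_one]
    | succ j =>
      obtain ⟨α, β, e⟩ := exists_B_mul_gram hq0 hq j h
      refine ⟨c * (q ^ (j + 1) • gram q n m (j + 1) +
        (α • 1 + β • murphy q n m) * gram q n m j), ?_, by rw [e, mul_assoc]⟩
      rw [mul_add, mul_smul_comm, ← mul_assoc]
      refine add_mem (Submodule.smul_mem _ _ (mul_gram_mem_gramSpan hc' _))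
        (mul_gram_mem_gramSpan (mul_mem hc' (add_mem ?_ ?_)) _)
      · exact Subalgebra.smul_mem _ (one_mem _) α
      · exact Subalgebra.smul_mem _ (murphy_mem_murphyAlgebra q n m) β
  | zero => exact ⟨0, zero_mem _, by simp⟩
  | add x y _ _ hx hy =>
    obtain ⟨x', hx', ex⟩ := hx
    obtain ⟨y', hy', ey⟩ := hy
    exact ⟨x' + y', add_mem hx' hy', by rw [mul_add, add_mul, ex, ey]⟩
  | smul r x _ hx =>
    obtain ⟨x', hx', ex⟩ := hx
    exact ⟨r • x', Submodule.smul_mem _ r hx', by rw [mul_smul_comm, ex, smul_mul_assoc]⟩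

theorem hasSplitAnnihilator_of_mem_gramSpan {q : K} (hq0 : q ≠ 0) (hq : q ≠ 1) {n m : ℕ}
    (h : m ≤ n) {x : Hecke q n} (hx : x ∈ gramSpan q n m) : HasSplitAnnihilator K x := by
  induction m generalizing x with
  | zero =>
    exact hasSplitAnnihilator_of_mem_murphyAlgebra hq0 (mem_murphyAlgebra_of_mem_gramSpan_zero hx)
  | succ m ih =>
    obtain ⟨f, hf, g, e⟩ := exists_eq_add_mul_B hx
    obtain ⟨y, hy, e'⟩ := exists_B_mul_eq_mul_B hq0 hq h hx
    exact .of_intertwining e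
      (B_comm_of_forall_T_comm fun j hj => T_comm_of_mem_murphyAlgebra hj hf).symm e'
      (hasSplitAnnihilator_of_mem_murphyAlgebra hq0 hf) (ih (by omega) hy)

theorem hasSplitAnnihilator_randomToRandom {q : K} (hq0 : q ≠ 0) (hq : q ≠ 1) (n k : ℕ)
    (hk : qFactorial q k ≠ 0) : HasSplitAnnihilator K (randomToRandom q n k) := by
  refine hasSplitAnnihilator_of_mem_gramSpan hq0 hq le_rfl ?_
  have e := qFactorial_smul_randomToRandom q n k
  rw [randomToBottom, bottomToRandom, ← gram_eq] at e
  -- Dividing by the nonzero `[k]!_q` exhibits the shuffle as a scalar multiple of `gram q n n k`.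
  rw [← inv_smul_smul₀ hk (randomToRandom q n k), e, ← one_mul (gram q n n k)]
  exact Submodule.smul_mem _ _ (mul_gram_mem_gramSpan (one_mem _) k)

end SplitMurphy

/-! ### Specialization of the characteristic polynomial -/

section BaseChange

/-- The image of a spanning family under base change spans. -/
theorem span_range_baseChange {R S : Type*} [CommRing R] [CommRing S] (f : R →+* S) (q : R)
    (q' : S) (h : f q = q') (n : ℕ) {ι : Type*} {b : ι → Hecke q n}
    (hb : Submodule.span R (Set.range b) = ⊤) :
    Submodule.span S (Set.range fun i => baseChange f q q' h n (b i)) = ⊤ := by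
  set W := Submodule.span S (Set.range fun i => baseChange f q q' h n (b i)) with hW
  have h1 : ∀ x, baseChange f q q' h n x ∈ W := fun x => by
    have hx : x ∈ Submodule.span R (Set.range b) := hb ▸ Submodule.mem_top
    induction hx using Submodule.span_induction with
    | mem x hx =>
      obtain ⟨i, rfl⟩ := hx
      exact Submodule.subset_span ⟨i, rfl⟩
    | zero => rw [map_zero]; exact zero_mem _
    | add x y _ _ hx hy => rw [map_add]; exact add_mem hx hy
    | smul r x _ hx => rw [baseChange_smul]; exact W.smul_mem _ hx
  -- `f` need not be surjective, so the image is only a subring; its `S`-span is closed under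
  -- products and contains the generators.
  have h2 : ∀ y : Hecke q' n, y ∈ Submodule.span S (Set.range (baseChange f q q' h n)) := fun y => by
    have hy : y ∈ Algebra.adjoin S {x | ∃ i, 1 ≤ i ∧ i < n ∧ x = T q' n i} := by
      rw [adjoin_T]; trivial
    induction hy using Algebra.adjoin_induction with
    | mem x hx =>
      obtain ⟨i, _, _, rfl⟩ := hx
      exact Submodule.subset_span ⟨T q n i, baseChange_T f q q' h n i⟩
    | algebraMap r =>
      rw [Algebra.algebraMap_eq_smul_one]
      exact Submodule.smul_mem _ _ (Submodule.subset_span ⟨1, map_one _⟩)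
    | add x y _ _ hx hy => exact add_mem hx hy
    | mul x y _ _ hx hy =>
      have := Submodule.mul_mem_mul hx hy
      rw [Submodule.span_mul_span] at this
      refine Submodule.span_mono ?_ this
      rintro _ ⟨_, ⟨a, rfl⟩, _, ⟨b, rfl⟩, rfl⟩
      exact ⟨a * b, map_mul _ _ _⟩
  refine eq_top_iff.2 fun y _ => (Submodule.span_le.2 ?_) (h2 y)
  rintro _ ⟨x, rfl⟩
  exact h1 x

/-- A basis maps to a basis, and the matrix of right multiplication in the new basis is the
entrywise image of the old one. -/
theorem charpoly_mulRight_baseChange {R S : Type*} [CommRing R] [CommRing S] (f : R →+* S) (q : R)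
    (q' : S) (h : f q = q') (n : ℕ) (x : Hecke q n) :
    (LinearMap.mulRight S (baseChange f q q' h n x)).charpoly =
      (LinearMap.mulRight R x).charpoly.map f := by
  classical
  let b : Module.Basis (Equiv.Perm (Fin n)) R (Hecke q n) := .ofRepr (exists_linearEquiv q n).some
  let v := fun i => baseChange f q q' h n (b i)
  have hv : Submodule.span S (Set.range v) = ⊤ := span_range_baseChange f q q' h n b.span_eq
  -- The images span a free module whose rank equals their number; a surjective endomorphism of a
  -- finite module is injective.
  have hli : LinearIndependent S v := by
    let g : (Equiv.Perm (Fin n) →₀ S) →ₗ[S] Hecke q' n := Finsupp.linearCombination S v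
    have hg : Function.Surjective g := by
      rw [← LinearMap.range_eq_top, Finsupp.range_linearCombination, hv]
    let e := (exists_linearEquiv q' n).some
    have : Function.Injective (e.toLinearMap.comp g) :=
      OrzechProperty.injective_of_surjective_endomorphism _ (e.surjective.comp hg)
    exact fun a c hac => this (congrArg e hac)
  let b' : Module.Basis (Equiv.Perm (Fin n)) S (Hecke q' n) := .mk hli hv.ge
  have hb' : ∀ i, b' i = baseChange f q q' h n (b i) := Module.Basis.mk_apply hli hv.ge
  rw [← LinearMap.charpoly_toMatrix _ b', ← LinearMap.charpoly_toMatrix _ b, ← Matrix.charpoly_map]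
  congr 1
  ext i j
  rw [LinearMap.toMatrix_apply, Matrix.map_apply, LinearMap.toMatrix_apply,
    LinearMap.mulRight_apply, LinearMap.mulRight_apply, hb', ← map_mul]
  have key : ∀ y, b'.repr (baseChange f q q' h n y) i = f (b.repr y i) := fun y => by
    conv_lhs => rw [← b.sum_repr y]
    simp only [map_sum, baseChange_smul, ← hb', map_smul, Module.Basis.repr_self]
    simp [Finsupp.single_apply]
  exact key _

theorem charpoly_mulRight_randomToRandom {R : Type*} [CommRing R] (q : R) (n k : ℕ) :
    (LinearMap.mulRight R (randomToRandom q n k)).charpoly =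
      (LinearMap.mulRight ℤ[X] (genericRandomToRandom n k)).charpoly.map
        (aeval q : ℤ[X] →ₐ[ℤ] R).toRingHom :=
  charpoly_mulRight_baseChange _ _ _ _ _ _

/-- A ring homomorphism out of `ℤ[X]` is evaluation at the image of `X`; this form fits the
embedding into the fraction field. -/
theorem charpoly_mulRight_randomToRandom_map_X {R : Type*} [CommRing R] (f : ℤ[X] →+* R)
    (n k : ℕ) : (LinearMap.mulRight R (randomToRandom (f X) n k)).charpoly =
      (LinearMap.mulRight ℤ[X] (genericRandomToRandom n k)).charpoly.map f := by
  rw [charpoly_mulRight_randomToRandom]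
  congr 1
  ext <;> simp

end BaseChange

/-! ### From a split annihilator to a split characteristic polynomial -/

section Splitting

/-- The characteristic polynomial of a matrix divides a power of every polynomial that annihilates
the matrix. -/
theorem charpoly_dvd_pow_of_aeval_eq_zero {R ι : Type*} [CommRing R] [Fintype ι] [DecidableEq ι]
    (M : Matrix ι ι R) {p : R[X]} (hp : aeval M p = 0) : M.charpoly ∣ p ^ Fintype.card ι := by
  let M' : Matrix ι ι R[X] := M.map C
  let P : R[X][X] := p.map C
  have h1 : (X - C (X : R[X])) ∣ P - C (P.eval X) := by
    rw [dvd_iff_isRoot]; simp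
  -- With an outer variable `Y`, `p(Y) - p(X)` is `(Y - X) Q`. Substituting `M` for `Y` gives `-p(X)
  -- = (M - X) Q(M)` as matrices over `R[X]`, and determinants yield the divisibility.
  obtain ⟨Q, hQ⟩ := h1
  have h2 := congrArg (aeval M') hQ
  have hP : aeval M' P = 0 := by
    have hM : M' = (CAlgHom : R →ₐ[R] R[X]).mapMatrix M := rfl
    rw [show P = p.map (algebraMap R R[X]) from rfl, aeval_map_algebraMap, hM,
      aeval_algHom_apply, hp, map_zero]
  have hev : P.eval X = p := by simp [P, eval_map, eval₂_C_X]
  rw [map_sub, hP, aeval_C, hev, map_mul, map_sub, aeval_X, aeval_C] at h2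
  have h3 := congrArg Matrix.det h2
  rw [Matrix.det_mul] at h3
  have h4 : (M' - algebraMap R[X] _ X).det = (-1) ^ Fintype.card ι * M.charpoly := by
    rw [Matrix.charpoly, Matrix.charmatrix, ← Matrix.det_neg, neg_sub]; rfl
  rw [h4, zero_sub, Matrix.det_neg, Matrix.algebraMap_eq_diagonal, Matrix.det_diagonal,
    mul_assoc] at h3
  have h5 := ((isUnit_neg_one (α := R[X])).pow (Fintype.card ι)).mul_left_cancel h3
  refine ⟨_, Eq.trans ?_ h5⟩
  simp

/-- A polynomial that annihilates `a` annihilates right multiplication by `a`, so the characteristic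
polynomial divides a power of it. -/
theorem splits_charpoly_mulRight {K : Type*} [Field K] {H : Type*} [Ring H] [Algebra K H]
    [Module.Finite K H] {a : H} (ha : HasSplitAnnihilator K a) :
    (LinearMap.mulRight K a).charpoly.Splits := by
  classical
  obtain ⟨p, hp0, hp, h⟩ := ha
  let b := Module.finBasis K H
  have hr : aeval (LinearMap.mulRight K a) p = 0 := by
    have : aeval (LinearMap.mulRight K a) p = LinearMap.mulRight K (aeval a p) := by
      clear h hp hp0
      induction p using Polynomial.induction_on' with
      | add p r hp hr =>
        rw [map_add, map_add, hp, hr]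
        ext x
        simp [mul_add]
      | monomial i c =>
        rw [aeval_monomial, aeval_monomial, LinearMap.pow_mulRight]
        ext x
        simp [← Algebra.smul_def]
    rw [this, h, LinearMap.mulRight_zero_eq_zero]
  have hM : aeval (LinearMap.toMatrix b b (LinearMap.mulRight K a)) p = 0 := by
    have := aeval_algHom_apply (LinearMap.toMatrixAlgEquiv b).toAlgHom (LinearMap.mulRight K a) p
    rw [hr, map_zero] at this
    exact this
  rw [← LinearMap.charpoly_toMatrix _ b]
  exact (hp.pow _).of_dvd (pow_ne_zero _ hp0) (charpoly_dvd_pow_of_aeval_eq_zero _ hM)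

/-- A monic polynomial over an integrally closed domain that splits over the fraction field
splits. -/
theorem splits_of_splits_map_fractionRing {A : Type*} [CommRing A] [IsDomain A]
    [IsIntegrallyClosed A] {p : A[X]} (hp : p.Monic)
    (h : (p.map (algebraMap A (FractionRing A))).Splits) : p.Splits := by
  -- Every root in the fraction field is integral over `A`, hence lies in `A`.
  refine h.of_splits_map_of_injective (IsFractionRing.injective A (FractionRing A)) fun r hr => ?_
  refine IsIntegrallyClosed.isIntegral_iff.1 ⟨p, hp, ?_⟩
  rw [← eval_map]
  exact isRoot_of_mem_roots hr

/-- In the fraction field of `ℤ[X]` the image of `X` is neither `0` nor `1` and no `q`-factorial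
vanishes, so all the divisions above are legitimate. -/
theorem splits_charpoly_genericRandomToRandom (n k : ℕ) :
    (LinearMap.mulRight ℤ[X] (genericRandomToRandom n k)).charpoly.Splits := by
  have hinj := IsFractionRing.injective ℤ[X] (FractionRing ℤ[X])
  refine splits_of_splits_map_fractionRing (LinearMap.charpoly_monic _) ?_
  rw [← charpoly_mulRight_randomToRandom_map_X]
  refine splits_charpoly_mulRight (hasSplitAnnihilator_randomToRandom ?_ ?_ n k ?_)
  · exact (map_ne_zero_iff _ hinj).2 X_ne_zero
  · rw [← map_one (algebraMap ℤ[X] (FractionRing ℤ[X])), hinj.ne_iff]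
    exact fun h => by simpa using congrArg (eval 0) h
  · have : qFactorial (algebraMap ℤ[X] (FractionRing ℤ[X]) X) k =
        algebraMap ℤ[X] (FractionRing ℤ[X]) (qFactorial X k) := by
      simp [qFactorial, qInt]
    rw [this]
    exact (map_ne_zero_iff _ hinj).2 (qFactorial_X_ne_zero k)

end Splitting
end QShuffle

theorem mainTheorem9 (n k : ℕ) :
    ∃ P : Multiset ℤ[X], ∀ (𝕜 : Type*) [CommRing 𝕜] (q : 𝕜),
      (LinearMap.mulRight 𝕜 (QShuffle.randomToRandom q n k)).charpoly =
          (P.map fun p => (X : 𝕜[X]) - C (aeval q p)).prod ∧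
        (IsDomain 𝕜 → ∀ μ : 𝕜,
          Module.End.HasEigenvalue (LinearMap.mulRight 𝕜 (QShuffle.randomToRandom q n k)) μ →
            ∃ p ∈ P, μ = aeval q p) := by
  have hs := QShuffle.splits_charpoly_genericRandomToRandom n k
  -- The polynomials are the roots in `ℤ[X]`, with multiplicity, of the generic characteristic
  -- polynomial, so they depend on `n` and `k` only.
  refine ⟨(LinearMap.mulRight ℤ[X] (QShuffle.genericRandomToRandom n k)).charpoly.roots,
    fun 𝕜 _ q => ?_⟩
  have h := QShuffle.charpoly_mulRight_randomToRandom q n k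
  rw [hs.eq_prod_roots_of_monic (LinearMap.charpoly_monic _), Polynomial.map_multiset_prod,
    Multiset.map_map] at h
  simp only [Function.comp_def, Polynomial.map_sub, map_X, map_C] at h
  refine ⟨h, fun _ μ hμ => ?_⟩
  rw [Module.End.hasEigenvalue_iff_isRoot_charpoly, h, IsRoot.def, eval_multiset_prod,
    Multiset.prod_eq_zero_iff, Multiset.map_map, Multiset.mem_map] at hμ
  obtain ⟨p, hp, h0⟩ := hμ
  refine ⟨p, hp, ?_⟩
  simpa [sub_eq_zero] using h0
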